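/- Let $s\in(0,1)$, $p\in[0,1]$, $q\in(0,1]$. The minimal random walk with parameters $s,p,q$ has steps $X_1,X_2,\dots\in\{0,1\}$ and positions $S_0=0$, $S_n=X_1+\dots+X_n$, where $X_1$ is Bernoulli with parameter $s$ and, for every $n\ge 1$, a time $k(n+1)$ is chosen uniformly at random in $\{1,\dots,n\}$, independently of $X_1,\dots,X_n$, and then, conditionally on $X_1,\dots,X_n$ and $k(n+1)$, the step $X_{n+1}$ is Bernoulli with parameter $p$ if $X_{k(n+1)}=1$ and with parameter $q$ if $X_{k(n+1)}=0$. Put $\alpha=p-q$. If $\alpha=1/2$, then for every integer $r\ge 1$, almost surely $$\lim_{n\to\infty}\frac{1}{\log\log n}\sum_{k=2}^n\Big(\frac{1}{\log k}\Big)^{r+1}k^{r-1}\Big(\frac{S_k}{k}-2q\Big)^{2r}=\frac{(4q(1-p))^r\,(2r)!}{2^r\,r!}.$$ -/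

import Mathlib

open MeasureTheory ProbabilityTheory Filter Topology

noncomputable section

namespace MinimalRandomWalk

variable {Ω : Type*}

/-- The σ-algebra generated by the first `n` steps `X 1, …, X n`. -/
@[reducible] def history (X : ℕ → Ω → ℝ) (n : ℕ) : MeasurableSpace Ω :=
  ⨆ k ∈ Set.Icc 1 n, MeasurableSpace.comap (X k) inferInstance

/-- The position `S n = X 1 + ⋯ + X n`, so that `S 0 = 0` and `S (n + 1) = S n + X (n + 1)`. -/
def position (X : ℕ → Ω → ℝ) (n : ℕ) (ω : Ω) : ℝ :=
  ∑ k ∈ Finset.Icc 1 n, X k ω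

/-- `X 1, X 2, …` are the steps of a minimal random walk with parameters `s`, `p`, `q`, and
`K n` (for `n ≥ 2`) is the past time that the walker recalls before making step `n`.
The values `X 0`, `K 0`, `K 1` play no role. -/
structure IsMRW [MeasurableSpace Ω] (P : Measure Ω) (s p q : ℝ)
    (X : ℕ → Ω → ℝ) (K : ℕ → Ω → ℕ) : Prop where
  measurable_step : ∀ n, 1 ≤ n → Measurable (X n)
  measurable_recall : ∀ n, 2 ≤ n → Measurable (K n)
  /-- Every step is `0` or `1`. -/
  step_mem : ∀ n, 1 ≤ n → ∀ ω, X n ω = 0 ∨ X n ω = 1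
  /-- The first step is Bernoulli with parameter `s`. -/
  first_step : P.real {ω | X 1 ω = 1} = s
  /-- The time recalled before step `n + 1` lies in the past `{1, …, n}`. -/
  recall_mem : ∀ n, 1 ≤ n → ∀ ω, K (n + 1) ω ∈ Finset.Icc 1 n
  /-- The time recalled before step `n + 1` is uniform on `{1, …, n}`. -/
  recall_uniform : ∀ n, 1 ≤ n → ∀ k ∈ Finset.Icc 1 n,
    P.real {ω | K (n + 1) ω = k} = 1 / (n : ℝ)
  /-- The recalled time is chosen independently of the first `n` steps. -/
  recall_indep : ∀ n, 1 ≤ n →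
    Indep (MeasurableSpace.comap (K (n + 1)) inferInstance) (history X n) P
  /-- Given the first `n` steps and the recalled time, step `n + 1` is Bernoulli with parameter
  `p` if the recalled step is `1`, and with parameter `q` if the recalled step is `0`. -/
  step_law : ∀ n, 1 ≤ n →
    P⟦{ω | X (n + 1) ω = 1} |
        history X n ⊔ MeasurableSpace.comap (K (n + 1)) inferInstance⟧
      =ᵐ[P] fun ω => if X (K (n + 1) ω) ω = 1 then p else q

end MinimalRandomWalk

end

/-! Given the past, step `n + 1` has success probability `q + (S n / n) / 2`. Hence `S n - 2 * q *
n` is multiplied by `1 + 1 / (2 * n)` at each step and receives a bounded martingale difference `ε`.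
Rescaling by `√(n log n)` gives `x (n + 1) = β x n + h ε` with `β ^ 2 ≈ 1 - δ`, `h ^ 2 ≈ δ`, `δ = 1
/ (n log n)`. The conditional variance of `ε` is close to `σ2 = 4 * q * (1 - p)`. In the time `∑ δ ~
log log n` this resembles an Ornstein–Uhlenbeck process with stationary law `N(0, σ2)`. Each summand
of the theorem is exactly `δ k * x k ^ (2 * r)`, so the claim is an ergodic theorem for the even
moments of that law.

The ergodic theorem (`ae_tendsto_weighted_sum`) goes by induction on `r`. Up to a small error
(`exists_abs_incrementError_le`), the increment of `x ^ (2 * r + 2)` is `-(r + 1) δ x ^ (2 * r + 2)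
+ (r + 1) (2 * r + 1) σ2 δ x ^ (2 * r)` plus a multiple of `ε`. Sum this and divide by `D = 1 + ∑
δ`. Moment bounds (`exists_moment_le`) make the errors summable almost surely; `L²` martingale
convergence and Kronecker's lemma remove the noise; `ae_tendsto_pow_div` removes the boundary term.
What remains says that each limiting average is `(2 * r + 1) σ2` times the previous one, which is
the recursion of the Gaussian moments.

Everything up to there is abstract in `β`, `h`, `δ`; the walk enters only through
`IsMRW.isPerturbedRecursion`. -/

namespace MinimalRandomWalk

/-! ### Elementary estimates: powers, perturbed recursions, Kronecker's lemma. -/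

/-- Second-order Taylor expansion of a power, with a cubic remainder. -/
theorem exists_abs_add_pow_sub_le (N : ℕ) : ∃ C : ℝ, 0 ≤ C ∧ ∀ a b : ℝ, |b| ≤ 1 →
    |(a + b) ^ N - (a ^ N + N * a ^ (N - 1) * b + (N * (N - 1) / 2 : ℝ) * a ^ (N - 2) * b ^ 2)|
      ≤ C * |b| ^ 3 * (1 + |a|) ^ N := by
  induction N with
  | zero => exact ⟨0, le_rfl, fun a b _ => by simp⟩
  | succ N ih =>
    obtain ⟨C, hC, h⟩ := ih
    refine ⟨C + |(N * (N - 1) / 2 : ℝ)|, by positivity, fun a b hb => ?_⟩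
    set R := (a + b) ^ N -
      (a ^ N + N * a ^ (N - 1) * b + (N * (N - 1) / 2 : ℝ) * a ^ (N - 2) * b ^ 2) with hR
    have key : (a + b) ^ (N + 1) - (a ^ (N + 1) + (N + 1 : ℕ) * a ^ (N + 1 - 1) * b +
        ((N + 1 : ℕ) * ((N + 1 : ℕ) - 1) / 2 : ℝ) * a ^ (N + 1 - 2) * b ^ 2)
        = (a + b) * R + (N * (N - 1) / 2 : ℝ) * a ^ (N - 2) * b ^ 3 := by
      rw [hR]
      rcases N with _ | _ | N
      · simp
      · simp; ring
      · simp only [Nat.add_sub_cancel, show N + 1 + 1 - 2 = N by omega,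
          show N + 1 + 1 + 1 - 2 = N + 1 by omega]
        push_cast
        ring
    rw [key]
    have hab : |a + b| ≤ 1 + |a| := by
      have := abs_add_le a b
      linarith
    have h1 : |a| ^ (N - 2) ≤ (1 + |a|) ^ (N + 1) :=
      (pow_le_pow_left₀ (abs_nonneg a) (by linarith) _).trans
        (pow_le_pow_right₀ (by linarith [abs_nonneg a]) (by omega))
    calc |(a + b) * R + (N * (N - 1) / 2 : ℝ) * a ^ (N - 2) * b ^ 3|
        ≤ |a + b| * |R| + |(N * (N - 1) / 2 : ℝ)| * |a| ^ (N - 2) * |b| ^ 3 := by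
          refine (abs_add_le _ _).trans_eq ?_
          simp only [abs_mul, abs_pow]
      _ ≤ (1 + |a|) * (C * |b| ^ 3 * (1 + |a|) ^ N) +
          |(N * (N - 1) / 2 : ℝ)| * (1 + |a|) ^ (N + 1) * |b| ^ 3 := by
          gcongr
          exact h a b hb
      _ = _ := by ring

/-- First-order expansion of `u ^ m` at `u = 1`, on the unit interval. -/
theorem exists_abs_pow_sub_le (m : ℕ) : ∃ C : ℝ, 0 ≤ C ∧ ∀ u : ℝ, 0 ≤ u → u ≤ 1 →
    |u ^ m - 1 - m * (u - 1)| ≤ C * (u - 1) ^ 2 := by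
  induction m with
  | zero => exact ⟨0, le_rfl, fun u _ _ => by simp⟩
  | succ m ih =>
    obtain ⟨C, hC, h⟩ := ih
    refine ⟨C + m, by positivity, fun u hu hu1 => ?_⟩
    have key : u ^ (m + 1) - 1 - (m + 1 : ℕ) * (u - 1)
        = u * (u ^ m - 1 - m * (u - 1)) + m * (u - 1) ^ 2 := by
      push_cast
      ring
    rw [key]
    calc |u * (u ^ m - 1 - m * (u - 1)) + m * (u - 1) ^ 2|
        ≤ u * |u ^ m - 1 - m * (u - 1)| + m * (u - 1) ^ 2 := by
          refine (abs_add_le _ _).trans_eq ?_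
          rw [abs_mul, abs_of_nonneg hu, abs_of_nonneg (by positivity : 0 ≤ (m : ℝ) * (u - 1) ^ 2)]
      _ ≤ 1 * (C * (u - 1) ^ 2) + m * (u - 1) ^ 2 := by
          gcongr
          exact h u hu hu1
      _ = _ := by ring

/-- A perturbed affine contraction with summable perturbation is bounded. -/
theorem exists_bound_of_recursion {E δ γ : ℕ → ℝ} {A C : ℝ} (hA : 0 ≤ A) (hC : 0 ≤ C)
    (hδ : ∀ n, 0 ≤ δ n) (hδ1 : ∀ n, δ n ≤ 1) (hγ : ∀ n, 0 ≤ γ n)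
    (hs : Summable γ)
    (h : ∀ n, E (n + 1) ≤ (1 - δ n) * E n + A * δ n + C * γ n * (1 + E n)) :
    ∃ B, ∀ n, E n ≤ B := by
  -- The affine part cannot raise `max (E n) A`, so only the factor `1 + C * γ n` is lost; the `+ 1`
  -- absorbs the constant in `1 + E n`.
  have main : ∀ n, max (E n) A + 1 ≤
      (max (E 0) A + 1) * Real.exp (C * ∑ k ∈ Finset.range n, γ k) := by
    intro n
    induction n with
    | zero => simp
    | succ n ih =>
      have h1 : max (E (n + 1)) A + 1 ≤ (max (E n) A + 1) * (1 + C * γ n) := by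
        have hEm := le_max_left (E n) A
        have hAm := le_max_right (E n) A
        have hCγ : 0 ≤ C * γ n := mul_nonneg hC (hγ n)
        have h2 : (1 - δ n) * E n + A * δ n ≤ max (E n) A := by
          nlinarith [mul_le_mul_of_nonneg_left hEm (sub_nonneg.2 (hδ1 n)),
            mul_le_mul_of_nonneg_left hAm (hδ n)]
        have h3 : C * γ n * (1 + E n) ≤ C * γ n * (max (E n) A + 1) :=
          mul_le_mul_of_nonneg_left (by linarith) hCγ
        have h4 : 0 ≤ C * γ n * (max (E n) A + 1) :=
          mul_nonneg hCγ (by linarith)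
        rcases max_cases (E (n + 1)) A with ⟨h5, _⟩ | ⟨h5, _⟩ <;> rw [h5]
        · linarith [h n]
        · linarith
      have hpos : 0 ≤ max (E 0) A + 1 := by
        have := le_max_right (E 0) A
        linarith
      calc max (E (n + 1)) A + 1 ≤ (max (E n) A + 1) * (1 + C * γ n) := h1
        _ ≤ ((max (E 0) A + 1) * Real.exp (C * ∑ k ∈ Finset.range n, γ k)) *
            Real.exp (C * γ n) := by
          gcongr
          · have := mul_nonneg hC (hγ n)
            linarith
          · linarith [Real.add_one_le_exp (C * γ n)]
        _ = _ := by rw [Finset.sum_range_succ, mul_add, Real.exp_add]; ring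
  refine ⟨(max (E 0) A + 1) * Real.exp (C * ∑' k, γ k), fun n => ?_⟩
  have h1 := main n
  have h2 : ∑ k ∈ Finset.range n, γ k ≤ ∑' k, γ k := hs.sum_le_tsum _ fun i _ => hγ i
  have hpos : 0 ≤ max (E 0) A + 1 := by
    have := le_max_right (E 0) A
    linarith
  calc E n ≤ max (E n) A + 1 := by linarith [le_max_left (E n) A]
    _ ≤ _ := h1
    _ ≤ _ := by gcongr

/-- Kronecker's lemma. -/
theorem tendsto_weighted_sum_div {a e : ℕ → ℝ} (ha : Monotone a) (hpos : ∀ n, 0 < a n)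
    (htop : Tendsto a atTop atTop) {l : ℝ}
    (he : Tendsto (fun n => ∑ k ∈ Finset.range n, e k) atTop (𝓝 l)) :
    Tendsto (fun n => (∑ k ∈ Finset.range n, a k * e k) / a n) atTop (𝓝 0) := by
  set t : ℕ → ℝ := fun n => ∑ k ∈ Finset.range n, e k - l with ht
  have ht0 : Tendsto t atTop (𝓝 0) := by simpa using he.sub_const l
  -- Summation by parts against `t`, which tends to `0`; the remaining sum is an average of `t` with
  -- weights of total mass `a n - a 0`.
  have abel : ∀ n, ∑ k ∈ Finset.range n, a k * e k
      = a n * t n - a 0 * t 0 - ∑ k ∈ Finset.range n, (a (k + 1) - a k) * t (k + 1) := by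
    intro n
    induction n with
    | zero => simp
    | succ n ih =>
      have : e n = t (n + 1) - t n := by simp [ht, Finset.sum_range_succ]
      rw [Finset.sum_range_succ, Finset.sum_range_succ, ih, this]
      ring
  have hsum : ∀ n, ∑ k ∈ Finset.range n, (a (k + 1) - a k) = a n - a 0 :=
    fun n => Finset.sum_range_sub a n
  have hlo : (fun n => ∑ k ∈ Finset.range n, (a (k + 1) - a k) * t (k + 1)) =o[atTop]
      fun n => ∑ k ∈ Finset.range n, (a (k + 1) - a k) := by
    refine Asymptotics.IsLittleO.sum_range ?_ (fun n => sub_nonneg.2 (ha n.le_succ)) ?_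
    · have := (Asymptotics.isBigO_refl (fun n => a (n + 1) - a n) atTop).mul_isLittleO
        ((Asymptotics.isLittleO_one_iff ℝ).2 (ht0.comp (tendsto_add_atTop_nat 1)))
      simpa using this
    · simp_rw [hsum]
      exact tendsto_atTop_add_const_right _ _ htop
  have hlo' : (fun n => ∑ k ∈ Finset.range n, (a (k + 1) - a k) * t (k + 1)) =o[atTop] a := by
    refine hlo.trans_isBigO (Asymptotics.IsBigO.of_bound 1 (Eventually.of_forall fun n => ?_))
    rw [hsum, Real.norm_of_nonneg (sub_nonneg.2 (ha n.zero_le)), Real.norm_of_nonneg (hpos n).le]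
    linarith [hpos 0]
  have h1 : Tendsto (fun n => t n - a 0 * t 0 / a n -
      (∑ k ∈ Finset.range n, (a (k + 1) - a k) * t (k + 1)) / a n) atTop (𝓝 (0 - 0 - 0)) :=
    (ht0.sub (htop.const_div_atTop _)).sub hlo'.tendsto_div_nhds_zero
  simp only [sub_zero] at h1
  refine h1.congr fun n => ?_
  rw [abel]
  have := (hpos n).ne'
  field_simp

/-! ### The intrinsic time `D = 1 + ∑ δ`. -/

/-- The partial sums of `δ`, shifted by `1` to be positive. -/
noncomputable def cumWeight (δ : ℕ → ℝ) (n : ℕ) : ℝ := 1 + ∑ k ∈ Finset.range n, δ k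

theorem cumWeight_succ (δ : ℕ → ℝ) (n : ℕ) : cumWeight δ (n + 1) = cumWeight δ n + δ n := by
  simp [cumWeight, Finset.sum_range_succ, add_assoc]

theorem one_le_cumWeight {δ : ℕ → ℝ} (hδ : ∀ n, 0 ≤ δ n) (n : ℕ) : 1 ≤ cumWeight δ n := by
  have := Finset.sum_nonneg fun k (_ : k ∈ Finset.range n) => hδ k
  simp only [cumWeight]
  linarith

theorem cumWeight_pos {δ : ℕ → ℝ} (hδ : ∀ n, 0 ≤ δ n) (n : ℕ) : 0 < cumWeight δ n :=
  one_pos.trans_le (one_le_cumWeight hδ n)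

theorem cumWeight_mono {δ : ℕ → ℝ} (hδ : ∀ n, 0 ≤ δ n) : Monotone (cumWeight δ) :=
  monotone_nat_of_le_succ fun n => by
    rw [cumWeight_succ]
    linarith [hδ n]

theorem summable_sub_inv_sq_cumWeight {δ : ℕ → ℝ} (hδ : ∀ n, 0 ≤ δ n) :
    Summable fun n => 1 / cumWeight δ n ^ 2 - 1 / cumWeight δ (n + 1) ^ 2 := by
  refine summable_of_sum_range_le (c := 1) (fun n => ?_) fun n => ?_
  · have h1 := cumWeight_pos hδ n
    have h2 := cumWeight_mono hδ n.le_succ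
    rw [sub_nonneg]
    gcongr
  · rw [Finset.sum_range_sub' fun n => 1 / cumWeight δ n ^ 2]
    have : 0 ≤ 1 / cumWeight δ n ^ 2 := by positivity
    simp only [cumWeight, Finset.range_zero, Finset.sum_empty] at this ⊢
    linarith

/-- Since `δ ≤ 1 ≤ D`, one step at most doubles `D`, so the terms are dominated by the telescoping
differences of `2 / D`. -/
theorem summable_div_sq_cumWeight {δ : ℕ → ℝ} (hδ : ∀ n, 0 ≤ δ n)
    (hδ1 : ∀ n, δ n ≤ 1) :
    Summable fun n => δ n / cumWeight δ n ^ 2 := by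
  refine summable_of_sum_range_le (c := 2) (fun n => div_nonneg (hδ n) (sq_nonneg _)) fun n => ?_
  have hle : ∀ k, δ k / cumWeight δ k ^ 2 ≤ 2 / cumWeight δ k - 2 / cumWeight δ (k + 1) := by
    intro k
    have h0 := one_le_cumWeight hδ k
    have h1 := cumWeight_pos hδ k
    have h2 := cumWeight_pos hδ (k + 1)
    have h3 := cumWeight_succ δ k
    rw [div_sub_div _ _ h1.ne' h2.ne', div_le_div_iff₀ (by positivity) (by positivity)]
    have h4 : cumWeight δ (k + 1) ≤ 2 * cumWeight δ k := by linarith [hδ1 k]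
    have h5 : 0 ≤ δ k * cumWeight δ k := mul_nonneg (hδ k) h1.le
    have := mul_le_mul_of_nonneg_left h4 h5
    rw [h3] at this ⊢
    nlinarith
  refine (Finset.sum_le_sum fun k _ => hle k).trans ?_
  rw [Finset.sum_range_sub' fun n => 2 / cumWeight δ n]
  have : 0 ≤ 2 / cumWeight δ n := div_nonneg (by norm_num) (cumWeight_pos hδ n).le
  simp only [cumWeight, Finset.range_zero, Finset.sum_empty] at this ⊢
  linarith

theorem tendsto_cumWeight_atTop {δ : ℕ → ℝ} (hδ : ∀ n, 0 ≤ δ n) (hns : ¬ Summable δ) :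
    Tendsto (cumWeight δ) atTop atTop :=
  tendsto_atTop_add_const_left _ _ ((not_summable_iff_tendsto_nat_atTop_of_nonneg hδ).1 hns)

/-- If `∑ δ = ∞`, `∑ δ g < ∞` and `g` converges, then its limit is `0`. -/
theorem tendsto_zero_of_summable_mul {δ g : ℕ → ℝ} (hδ : ∀ n, 0 ≤ δ n) (hns : ¬ Summable δ)
    (hs : Summable fun n => δ n * g n) {l : ℝ} (hg : Tendsto g atTop (𝓝 l)) :
    Tendsto g atTop (𝓝 0) := by
  by_cases hl : l = 0
  · rwa [hl] at hg
  refine absurd (summable_of_isBigO_nat hs ?_) hns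
  have h1 : ∀ᶠ n in atTop, |l| / 2 ≤ |g n| :=
    hg.abs.eventually_const_le (by linarith [abs_pos.2 hl])
  refine Asymptotics.IsBigO.of_bound (2 / |l|) ?_
  filter_upwards [h1] with n hn
  have hl' := abs_pos.2 hl
  rw [Real.norm_eq_abs, Real.norm_eq_abs, abs_mul, abs_of_nonneg (hδ n)]
  calc δ n = 2 / |l| * (δ n * (|l| / 2)) := by field_simp
    _ ≤ _ := by
      gcongr
      exact hδ n

/-! ### Almost sure convergence of random series and martingale transforms. -/

/-- A series of integrable functions whose `L¹` norms are summable converges absolutely a.e. -/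
theorem ae_summable_of_summable_integral_abs {Ω : Type*} [MeasurableSpace Ω] {P : Measure Ω}
    {f : ℕ → Ω → ℝ} (hf : ∀ n, Integrable (f n) P) (hs : Summable fun n => ∫ ω, |f n ω| ∂P) :
    ∀ᵐ ω ∂P, Summable fun n => f n ω := by
  have h1 : ∀ n, eLpNorm (f n) 1 P = ENNReal.ofReal (∫ ω, |f n ω| ∂P) := fun n => by
    rw [eLpNorm_one_eq_lintegral_enorm, ← ofReal_integral_norm_eq_lintegral_enorm (hf n)]
    rfl
  have h2 : ∑' n, eLpNorm (f n) 1 P ≠ ⊤ := by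
    simp_rw [h1]
    rw [← ENNReal.ofReal_tsum_of_nonneg (fun n => integral_nonneg fun ω => abs_nonneg _) hs]
    exact ENNReal.ofReal_ne_top
  filter_upwards [summable_norm_of_tsum_eLpNorm_ne_top le_rfl
    (fun n => (hf n).aestronglyMeasurable) h2] with ω hω
  exact hω.of_norm

/-- `ε 0, ε 1, …` are martingale differences with values in `[-1, 1]`, where `ε n` is revealed at
time `n + 1`. -/
structure IsBoundedNoise {Ω : Type*} [m0 : MeasurableSpace Ω] (P : Measure Ω)
    (ℱ : Filtration ℕ m0) (ε : ℕ → Ω → ℝ) : Prop where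
  stronglyMeasurable : ∀ n, StronglyMeasurable[ℱ (n + 1)] (ε n)
  abs_le_one : ∀ n ω, |ε n ω| ≤ 1
  condExp_eq_zero : ∀ n, P[ε n | ℱ n] =ᵐ[P] 0

theorem integrable_of_abs_le {Ω : Type*} [m0 : MeasurableSpace Ω] {P : Measure Ω}
    [IsProbabilityMeasure P] {m : MeasurableSpace Ω} (hm : m ≤ m0) {Y : Ω → ℝ}
    (hY : StronglyMeasurable[m] Y) (hb : ∃ C, ∀ ω, |Y ω| ≤ C) : Integrable Y P := by
  obtain ⟨C, hC⟩ := hb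
  exact Integrable.of_bound (hY.mono hm).aestronglyMeasurable C (Eventually.of_forall hC)

namespace IsBoundedNoise

variable {Ω : Type*} [m0 : MeasurableSpace Ω] {P : Measure Ω} [IsProbabilityMeasure P]
  {ℱ : Filtration ℕ m0} {ε : ℕ → Ω → ℝ}

theorem integrable (h : IsBoundedNoise P ℱ ε) (n : ℕ) : Integrable (ε n) P :=
  integrable_of_abs_le (ℱ.le _) (h.stronglyMeasurable n) ⟨1, h.abs_le_one n⟩

theorem condExp_mul_eq_zero (h : IsBoundedNoise P ℱ ε) {n : ℕ} {Y : Ω → ℝ}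
    (hY : StronglyMeasurable[ℱ n] Y) (hb : ∃ C, ∀ ω, |Y ω| ≤ C) :
    P[fun ω => Y ω * ε n ω | ℱ n] =ᵐ[P] 0 := by
  obtain ⟨C, hC⟩ := hb
  filter_upwards [condExp_stronglyMeasurable_mul_of_bound (ℱ.le n) hY (h.integrable n) C
    (Eventually.of_forall hC), h.condExp_eq_zero n] with ω h1 h2
  refine h1.trans ?_
  simp [h2]

theorem integral_mul_eq_zero (h : IsBoundedNoise P ℱ ε) {n : ℕ} {Y : Ω → ℝ}
    (hY : StronglyMeasurable[ℱ n] Y) (hb : ∃ C, ∀ ω, |Y ω| ≤ C) :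
    ∫ ω, Y ω * ε n ω ∂P = 0 := by
  rw [← integral_condExp (ℱ.le n), integral_congr_ae (h.condExp_mul_eq_zero hY hb)]
  simp

/-- A martingale transform that is bounded in `L²` converges almost surely. -/
theorem ae_exists_tendsto_sum_mul (h : IsBoundedNoise P ℱ ε) {Y : ℕ → Ω → ℝ}
    (hY : ∀ n, StronglyMeasurable[ℱ n] (Y n)) (hb : ∀ n, ∃ C, ∀ ω, |Y n ω| ≤ C)
    (hs : Summable fun n => ∫ ω, Y n ω ^ 2 ∂P) :
    ∀ᵐ ω ∂P, ∃ l, Tendsto (fun n => ∑ k ∈ Finset.range n, Y k ω * ε k ω) atTop (𝓝 l) := by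
  set N : ℕ → Ω → ℝ := fun n ω => ∑ k ∈ Finset.range n, Y k ω * ε k ω with hN
  have hNs : ∀ n ω, N (n + 1) ω = N n ω + Y n ω * ε n ω :=
    fun n ω => Finset.sum_range_succ _ _
  have hNm : ∀ n, StronglyMeasurable[ℱ n] (N n) := by
    intro n
    refine Finset.stronglyMeasurable_fun_sum _ fun k hk => ?_
    have hk' := Finset.mem_range.1 hk
    exact ((hY k).mono (ℱ.mono hk'.le)).mul ((h.stronglyMeasurable k).mono (ℱ.mono hk'))
  have hNb : ∀ n, ∃ C, ∀ ω, |N n ω| ≤ C := by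
    intro n
    induction n with
    | zero => exact ⟨0, fun ω => by simp [hN]⟩
    | succ n ih =>
      obtain ⟨A, hA⟩ := ih
      obtain ⟨B, hB⟩ := hb n
      refine ⟨A + B, fun ω => ?_⟩
      rw [hNs]
      refine (abs_add_le _ _).trans (add_le_add (hA ω) ?_)
      rw [abs_mul]
      have := mul_le_mul (hB ω) (h.abs_le_one n ω) (abs_nonneg _) ((abs_nonneg _).trans (hB ω))
      linarith
  have hNi : ∀ n, Integrable (N n) P := fun n => integrable_of_abs_le (ℱ.le n) (hNm n) (hNb n)
  have hmart : Martingale N ℱ P := by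
    refine martingale_of_condExp_sub_eq_zero_nat hNm hNi fun n => ?_
    have : N (n + 1) - N n = fun ω => Y n ω * ε n ω := by
      funext ω
      simp [hNs]
    rw [this]
    exact h.condExp_mul_eq_zero (hY n) (hb n)
  have hsq : ∀ {Z : Ω → ℝ}, (∃ C, ∀ ω, |Z ω| ≤ C) → ∃ C, ∀ ω, |Z ω ^ 2| ≤ C := by
    rintro Z ⟨C, hC⟩
    exact ⟨C ^ 2, fun ω => by
      rw [abs_pow]
      exact pow_le_pow_left₀ (abs_nonneg _) (hC ω) 2⟩
  have hNi2 : ∀ n, Integrable (fun ω => N n ω ^ 2) P := fun n =>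
    integrable_of_abs_le (ℱ.le n) ((hNm n).pow 2) (hsq (hNb n))
  have hYi2 : ∀ n, Integrable (fun ω => Y n ω ^ 2) P := fun n =>
    integrable_of_abs_le (ℱ.le n) ((hY n).pow 2) (hsq (hb n))
  have hNYm : ∀ n, StronglyMeasurable[ℱ n] fun ω => 2 * N n ω * Y n ω := fun n =>
    ((hNm n).const_mul 2).mul (hY n)
  have hNYb : ∀ n, ∃ C, ∀ ω, |2 * N n ω * Y n ω| ≤ C := by
    intro n
    obtain ⟨A, hA⟩ := hNb n
    obtain ⟨B, hB⟩ := hb n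
    refine ⟨2 * A * B, fun ω => ?_⟩
    rw [abs_mul, abs_mul, abs_two]
    have hA0 := (abs_nonneg _).trans (hA ω)
    gcongr
    · exact hA ω
    · exact hB ω
  have hmix : ∀ n, Integrable (fun ω => 2 * N n ω * Y n ω * ε n ω) P := fun n =>
    (integrable_of_abs_le (ℱ.le n) (hNYm n) (hNYb n)).mul_bdd (c := 1)
      (h.integrable n).aestronglyMeasurable (Eventually.of_forall (h.abs_le_one n))
  -- Martingale increments are orthogonal and `ε ^ 2 ≤ 1`, so no conditional variance is needed.
  have hL2 : ∀ n, ∫ ω, N n ω ^ 2 ∂P ≤ ∑ k ∈ Finset.range n, ∫ ω, Y k ω ^ 2 ∂P := by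
    intro n
    induction n with
    | zero => simp [hN]
    | succ n ih =>
      rw [Finset.sum_range_succ]
      calc ∫ ω, N (n + 1) ω ^ 2 ∂P
          ≤ ∫ ω, (N n ω ^ 2 + 2 * N n ω * Y n ω * ε n ω + Y n ω ^ 2) ∂P := by
            refine integral_mono (hNi2 _) (((hNi2 n).add (hmix n)).add (hYi2 n)) fun ω => ?_
            have h1 : ε n ω ^ 2 ≤ 1 := (sq_le_one_iff_abs_le_one _).2 (h.abs_le_one n ω)
            have h2 := mul_le_mul_of_nonneg_left h1 (sq_nonneg (Y n ω))
            simp only [hNs]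
            nlinarith
        _ = ∫ ω, N n ω ^ 2 ∂P + 0 + ∫ ω, Y n ω ^ 2 ∂P := by
            rw [integral_add (f := fun ω => N n ω ^ 2 + 2 * N n ω * Y n ω * ε n ω)
              ((hNi2 n).add (hmix n)) (hYi2 n), integral_add (hNi2 n) (hmix n),
              h.integral_mul_eq_zero (hNYm n) (hNYb n)]
        _ ≤ _ := by linarith
  have hbd : ∀ n, eLpNorm (N n) 1 P ≤ ((1 + ∑' k, ∫ ω, Y k ω ^ 2 ∂P).toNNReal : ENNReal) := by
    intro n
    rw [eLpNorm_one_eq_lintegral_enorm, ← ofReal_integral_norm_eq_lintegral_enorm (hNi n)]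
    refine ENNReal.ofReal_le_ofReal ?_
    have h1 : ∫ ω, ‖N n ω‖ ∂P ≤ ∫ ω, (1 + N n ω ^ 2) ∂P := by
      refine integral_mono (hNi n).norm ((integrable_const _).add (hNi2 n)) fun ω => ?_
      simp only [Real.norm_eq_abs]
      nlinarith [sq_abs (N n ω), sq_nonneg (|N n ω| - 1)]
    rw [integral_add (integrable_const _) (hNi2 n)] at h1
    have h2 := hs.sum_le_tsum (Finset.range n) fun k _ => integral_nonneg fun ω => sq_nonneg (Y k ω)
    have h3 := hL2 n
    simp only [integral_const, probReal_univ, one_smul] at h1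
    linarith
  filter_upwards [hmart.submartingale.ae_tendsto_limitProcess hbd] with ω hω
  exact ⟨_, hω⟩

end IsBoundedNoise

/-! ### Perturbed recursions and the increments of even powers. -/

/-- The process `x` satisfies `x (n + 1) = β n * x n + h n * ε n` with bounded martingale
differences `ε` whose conditional variance is close to `σ2`, and with coefficients satisfying
`β n ^ 2 ≈ 1 - δ n` and `h n ^ 2 ≈ δ n` up to a summable error `γ`. -/
structure IsPerturbedRecursion {Ω : Type*} [m0 : MeasurableSpace Ω] (P : Measure Ω)
    (ℱ : Filtration ℕ m0) (x ε b : ℕ → Ω → ℝ) (β h δ γ κ : ℕ → ℝ) (σ2 : ℝ) : Prop where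
  noise : IsBoundedNoise P ℱ ε
  stronglyMeasurable : ∀ n, StronglyMeasurable[ℱ n] (x n)
  bounded : ∀ n, ∃ C, ∀ ω, |x n ω| ≤ C
  step : ∀ n ω, x (n + 1) ω = β n * x n ω + h n * ε n ω
  stronglyMeasurable_b : ∀ n, StronglyMeasurable[ℱ n] (b n)
  abs_b_le : ∀ n ω, |b n ω| ≤ 1
  abs_sq_noise_le : ∀ n ω, |ε n ω ^ 2 - b n ω * ε n ω - σ2| ≤ κ n * |x n ω|
  β_nonneg : ∀ n, 0 ≤ β n
  β_le_one : ∀ n, β n ≤ 1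
  h_nonneg : ∀ n, 0 ≤ h n
  δ_nonneg : ∀ n, 0 ≤ δ n
  δ_le_one : ∀ n, δ n ≤ 1
  h_sq_le : ∀ n, h n ^ 2 ≤ δ n
  not_summable_δ : ¬ Summable δ
  summable_γ : Summable γ
  abs_β_le : ∀ n, |β n ^ 2 - 1 + δ n| ≤ γ n
  abs_h_le : ∀ n, |h n ^ 2 - δ n| ≤ γ n
  δ_sq_le : ∀ n, δ n ^ 2 ≤ γ n
  h_cube_le : ∀ n, h n ^ 3 ≤ γ n
  δ_mul_κ_le : ∀ n, δ n * κ n ≤ γ n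

/-- The coefficient of the noise in the increment of the power `2 * r + 2`. -/
noncomputable def noiseCoeff (r : ℕ) (β h b x : ℝ) : ℝ :=
  (2 * r + 2) * (β * x) ^ (2 * r + 1) * h +
    (r + 1) * (2 * r + 1) * (β * x) ^ (2 * r) * h ^ 2 * b

/-- The error term in the increment of the power `2 * r + 2`, where `x'` is the next value. -/
noncomputable def incrementError (r : ℕ) (σ2 δ β h b x x' ε : ℝ) : ℝ :=
  x' ^ (2 * r + 2) - x ^ (2 * r + 2) + (r + 1) * δ * x ^ (2 * r + 2) -
    (r + 1) * (2 * r + 1) * σ2 * (δ * x ^ (2 * r)) - noiseCoeff r β h b x * ε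

theorem one_add_abs_pow_le (x : ℝ) (m : ℕ) :
    (1 + |x|) ^ (2 * m) ≤ 2 ^ (2 * m - 1) * (1 + x ^ (2 * m)) := by
  have := add_pow_le zero_le_one (abs_nonneg x) (2 * m)
  rwa [one_pow, (even_two_mul m).pow_abs] at this

namespace IsPerturbedRecursion

variable {Ω : Type*} [m0 : MeasurableSpace Ω] {P : Measure Ω}
  {ℱ : Filtration ℕ m0} {x ε b : ℕ → Ω → ℝ} {β h δ γ κ : ℕ → ℝ} {σ2 : ℝ}

theorem γ_nonneg (S : IsPerturbedRecursion P ℱ x ε b β h δ γ κ σ2) (n : ℕ) : 0 ≤ γ n :=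
  (abs_nonneg _).trans (S.abs_β_le n)

-- Taylor expansion in `h * ε` up to second order, where the cubic remainder costs `h ^ 3 ≤ γ`. In
-- the quadratic term `ε ^ 2` is replaced by `σ2 + b * ε` at cost `κ * |x|`; the part `b * ε` is
-- again noise, which explains the second term of `noiseCoeff`. All other errors come from `β ^ 2 ≈
-- 1 - δ` and `h ^ 2 ≈ δ`.
set_option maxHeartbeats 800000 in
theorem exists_abs_incrementError_le (S : IsPerturbedRecursion P ℱ x ε b β h δ γ κ σ2) (r : ℕ) :
    ∃ C : ℝ, 0 ≤ C ∧ ∀ n ω,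
      |incrementError r σ2 (δ n) (β n) (h n) (b n ω) (x n ω) (x (n + 1) ω) (ε n ω)|
        ≤ C * γ n * (1 + |x n ω|) ^ (2 * r + 2) := by
  obtain ⟨C₁, hC₁, h₁⟩ := exists_abs_add_pow_sub_le (2 * r + 2)
  obtain ⟨C₂, hC₂, h₂⟩ := exists_abs_pow_sub_le (r + 1)
  obtain ⟨C₃, hC₃, h₃⟩ := exists_abs_pow_sub_le r
  set D : ℝ := (r + 1) * (2 * r + 1) with hD
  have hD0 : 0 ≤ D := by positivity
  refine ⟨C₁ + (3 * C₂ + (r + 1)) + D * (1 + |σ2| * (1 + 2 * (r + C₃))), by positivity,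
    fun n ω => ?_⟩
  have hγ := S.γ_nonneg n
  have hstep := S.step n ω
  have hnoise := S.noise.abs_le_one n ω
  have hw := S.abs_sq_noise_le n ω
  have hβ0 := S.β_nonneg n
  have hβ1 := S.β_le_one n
  have hh0 := S.h_nonneg n
  have hδ0 := S.δ_nonneg n
  have hδ1 := S.δ_le_one n
  have hhδ := S.h_sq_le n
  have hβγ := S.abs_β_le n
  have hhγ := S.abs_h_le n
  have hδγ := S.δ_sq_le n
  have hh3 := S.h_cube_le n
  have hδκ := S.δ_mul_κ_le n
  generalize x (n + 1) ω = x' at *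
  generalize x n ω = x at *
  generalize ε n ω = ε at *
  generalize b n ω = b at *
  generalize β n = β at *
  generalize h n = h at *
  generalize δ n = δ at *
  generalize γ n = γ at *
  generalize κ n = κ at *
  set u := β ^ 2 with hu
  have hu0 : 0 ≤ u := sq_nonneg _
  have hu1 : u ≤ 1 := pow_le_one₀ hβ0 hβ1
  have hh1 : h ≤ 1 := (sq_le_one_iff₀ hh0).1 (hhδ.trans hδ1)
  have h1x : 1 ≤ 1 + |x| := by linarith [abs_nonneg x]
  have hu1γ : |u - 1| ≤ δ + γ := by
    have : u - 1 = (u - 1 + δ) - δ := by ring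
    rw [this]
    refine (abs_sub _ _).trans ?_
    rw [abs_of_nonneg hδ0]
    linarith
  have hu1' : |u - 1| ≤ 1 := by rw [abs_le]; constructor <;> linarith
  have hδu : δ * |u - 1| ≤ 2 * γ := by
    calc δ * |u - 1| ≤ δ * (δ + γ) := mul_le_mul_of_nonneg_left hu1γ hδ0
      _ = δ ^ 2 + δ * γ := by ring
      _ ≤ γ + 1 * γ := by gcongr
      _ = 2 * γ := by ring
  have husq : (u - 1) ^ 2 ≤ 3 * γ := by
    calc (u - 1) ^ 2 = |u - 1| * |u - 1| := by rw [← sq_abs, sq]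
      _ ≤ |u - 1| * (δ + γ) := mul_le_mul_of_nonneg_left hu1γ (abs_nonneg _)
      _ = δ * |u - 1| + |u - 1| * γ := by ring
      _ ≤ 2 * γ + 1 * γ := by gcongr
      _ = 3 * γ := by ring
  have hpow : ∀ m : ℕ, β ^ (2 * m) = u ^ m := fun m => pow_mul _ _ _
  set R := (β * x + h * ε) ^ (2 * r + 2) - ((β * x) ^ (2 * r + 2) +
    (2 * r + 2) * (β * x) ^ (2 * r + 1) * (h * ε) + D * (β * x) ^ (2 * r) * (h * ε) ^ 2) with hR
  set w := ε ^ 2 - b * ε - σ2 with hw'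
  -- Three sources of error: the Taylor remainder, `β ^ (2 * r + 2)` against `1 - (r + 1) * δ`, and
  -- the quadratic term against its limiting form.
  have key : incrementError r σ2 δ β h b x x' ε = R +
      ((u ^ (r + 1) - 1 - (r + 1) * (u - 1)) + (r + 1) * (u - 1 + δ)) * x ^ (2 * r + 2) +
      D * x ^ (2 * r) * (u ^ r * h ^ 2 * w + σ2 * (u ^ r * (h ^ 2 - δ) +
        δ * ((u ^ r - 1 - r * (u - 1)) + r * (u - 1)))) := by
    rw [incrementError, noiseCoeff, hR, hw', hstep, ← hD]
    simp only [mul_pow β x, ← hpow]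
    rw [show 2 * (r + 1) = 2 * r + 2 by ring]
    ring
  have hRle : |R| ≤ C₁ * γ * (1 + |x|) ^ (2 * r + 2) := by
    have hbε : |h * ε| ≤ h := by
      rw [abs_mul, abs_of_nonneg hh0]
      exact mul_le_of_le_one_right hh0 hnoise
    have hβx : |β * x| ≤ |x| := by
      rw [abs_mul, abs_of_nonneg hβ0]
      exact mul_le_of_le_one_left (abs_nonneg _) hβ1
    have h5 := h₁ (β * x) (h * ε) (hbε.trans hh1)
    rw [show 2 * r + 2 - 1 = 2 * r + 1 by omega, show 2 * r + 2 - 2 = 2 * r by omega,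
      show ((2 * r + 2 : ℕ) : ℝ) * ((2 * r + 2 : ℕ) - 1) / 2 = D by push_cast; rw [hD]; ring] at h5
    push_cast at h5
    refine h5.trans ?_
    have h6 : |h * ε| ^ 3 ≤ γ := (pow_le_pow_left₀ (abs_nonneg _) hbε 3).trans hh3
    gcongr
  have hmid : |((u ^ (r + 1) - 1 - (r + 1) * (u - 1)) + (r + 1) * (u - 1 + δ)) * x ^ (2 * r + 2)|
      ≤ (3 * C₂ + (r + 1)) * γ * (1 + |x|) ^ (2 * r + 2) := by
    have h5 := h₂ u hu0 hu1
    push_cast at h5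
    rw [abs_mul, abs_pow]
    have h6 : |(u ^ (r + 1) - 1 - (r + 1) * (u - 1)) + (r + 1) * (u - 1 + δ)|
        ≤ (3 * C₂ + (r + 1)) * γ := by
      refine (abs_add_le _ _).trans ?_
      rw [abs_mul, abs_of_nonneg (by positivity : (0 : ℝ) ≤ r + 1)]
      calc _ ≤ C₂ * (3 * γ) + (r + 1) * γ :=
            add_le_add (h5.trans (mul_le_mul_of_nonneg_left husq hC₂))
              (mul_le_mul_of_nonneg_left hβγ (by positivity))
        _ = _ := by ring
    exact mul_le_mul h6 (pow_le_pow_left₀ (abs_nonneg x) (le_add_of_nonneg_left zero_le_one) _)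
      (by positivity) (by positivity)
  have hlast : |D * x ^ (2 * r) * (u ^ r * h ^ 2 * w + σ2 * (u ^ r * (h ^ 2 - δ) +
      δ * ((u ^ r - 1 - r * (u - 1)) + r * (u - 1))))|
      ≤ D * (1 + |σ2| * (1 + 2 * (r + C₃))) * γ * (1 + |x|) ^ (2 * r + 2) := by
    have hur0 : 0 ≤ u ^ r := pow_nonneg hu0 _
    have hur1 : u ^ r ≤ 1 := pow_le_one₀ hu0 hu1
    have h5 : |u ^ r * h ^ 2 * w| ≤ γ * |x| := by
      rw [abs_mul, abs_mul, abs_of_nonneg hur0, abs_of_nonneg (sq_nonneg h)]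
      calc u ^ r * h ^ 2 * |w| ≤ 1 * δ * (κ * |x|) := by gcongr
        _ = (δ * κ) * |x| := by ring
        _ ≤ _ := by gcongr
    have h6 : |u ^ r * (h ^ 2 - δ)| ≤ γ := by
      rw [abs_mul, abs_of_nonneg hur0]
      calc u ^ r * |h ^ 2 - δ| ≤ 1 * γ := by gcongr
        _ = γ := one_mul _
    have h7 : |δ * ((u ^ r - 1 - r * (u - 1)) + r * (u - 1))| ≤ 2 * (r + C₃) * γ := by
      rw [abs_mul, abs_of_nonneg hδ0]
      have h8 : |(u ^ r - 1 - r * (u - 1)) + r * (u - 1)| ≤ (r + C₃) * |u - 1| := by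
        refine (abs_add_le _ _).trans ?_
        have h9 := h₃ u hu0 hu1
        have h10 : (u - 1) ^ 2 ≤ |u - 1| := by
          rw [← sq_abs, sq]
          exact mul_le_of_le_one_left (abs_nonneg _) hu1'
        rw [abs_mul, Nat.abs_cast]
        calc _ ≤ C₃ * |u - 1| + r * |u - 1| :=
              add_le_add_left (h9.trans (mul_le_mul_of_nonneg_left h10 hC₃)) _
          _ = _ := by ring
      calc _ ≤ δ * ((r + C₃) * |u - 1|) := by gcongr
        _ = (r + C₃) * (δ * |u - 1|) := by ring
        _ ≤ (r + C₃) * (2 * γ) := by gcongr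
        _ = _ := by ring
    have h12 : |u ^ r * h ^ 2 * w + σ2 * (u ^ r * (h ^ 2 - δ) +
        δ * ((u ^ r - 1 - r * (u - 1)) + r * (u - 1)))|
        ≤ (1 + |σ2| * (1 + 2 * (r + C₃))) * γ * (1 + |x|) ^ 2 := by
      calc _ ≤ γ * |x| + |σ2| * (γ + 2 * (r + C₃) * γ) := by
            refine (abs_add_le _ _).trans (add_le_add h5 ?_)
            rw [abs_mul]
            gcongr
            exact (abs_add_le _ _).trans (add_le_add h6 h7)
        _ ≤ γ * (1 + |x|) ^ 2 + |σ2| * (γ + 2 * (r + C₃) * γ) * (1 + |x|) ^ 2 := by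
            have h13 : 1 ≤ (1 + |x|) ^ 2 := one_le_pow₀ h1x
            have h14 : |x| ≤ (1 + |x|) ^ 2 :=
              (le_add_of_nonneg_left zero_le_one).trans (le_self_pow₀ h1x two_ne_zero)
            exact add_le_add (mul_le_mul_of_nonneg_left h14 hγ)
              (le_mul_of_one_le_right (by positivity) h13)
        _ = _ := by ring
    rw [abs_mul, abs_mul, abs_pow, abs_of_nonneg hD0]
    calc _ ≤ D * (1 + |x|) ^ (2 * r) *
          ((1 + |σ2| * (1 + 2 * (r + C₃))) * γ * (1 + |x|) ^ 2) := by
          gcongr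
          exact le_add_of_nonneg_left zero_le_one
      _ = _ := by ring
  rw [key]
  refine ((abs_add_three _ _ _).trans (add_le_add_three hRle hmid hlast)).trans_eq ?_
  ring

/-- The factor `δ n`, from `h n ^ 2 ≤ δ n`, reduces `L²` convergence of a weighted noise series to
summability of `δ * w ^ 2`. -/
theorem noiseCoeff_sq_le (S : IsPerturbedRecursion P ℱ x ε b β h δ γ κ σ2) (r n : ℕ) (ω : Ω) :
    noiseCoeff r (β n) (h n) (b n ω) (x n ω) ^ 2
      ≤ ((2 * r + 2) + (r + 1) * (2 * r + 1)) ^ 2 * δ n * (1 + |x n ω|) ^ (4 * r + 2) := by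
  have hhδ := S.h_sq_le n
  have hh0 := S.h_nonneg n
  have hh1 : h n ≤ 1 := by nlinarith [S.δ_le_one n]
  have h1x : 1 ≤ 1 + |x n ω| := by linarith [abs_nonneg (x n ω)]
  have hβx : |β n * x n ω| ≤ 1 + |x n ω| := by
    rw [abs_mul, abs_of_nonneg (S.β_nonneg n)]
    nlinarith [abs_nonneg (x n ω), S.β_le_one n]
  have key : |noiseCoeff r (β n) (h n) (b n ω) (x n ω)| ≤
      ((2 * r + 2) + (r + 1) * (2 * r + 1)) * (1 + |x n ω|) ^ (2 * r + 1) * h n := by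
    rw [noiseCoeff]
    refine (abs_add_le _ _).trans ?_
    simp only [abs_mul, abs_pow, abs_of_nonneg hh0]
    rw [← abs_mul (β n), abs_of_nonneg (by positivity : (0 : ℝ) ≤ 2 * r + 2),
      abs_of_nonneg (by positivity : (0 : ℝ) ≤ r + 1),
      abs_of_nonneg (by positivity : (0 : ℝ) ≤ 2 * r + 1)]
    have h1 : |β n * x n ω| ^ (2 * r) ≤ (1 + |x n ω|) ^ (2 * r + 1) :=
      (pow_le_pow_left₀ (abs_nonneg _) hβx _).trans (pow_le_pow_right₀ h1x (by omega))
    have h2 : h n ^ 2 * |b n ω| ≤ h n := by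
      calc h n ^ 2 * |b n ω| ≤ h n ^ 2 * 1 := by
            gcongr
            exact S.abs_b_le n ω
        _ ≤ h n := by nlinarith
    calc _ = (2 * r + 2) * |β n * x n ω| ^ (2 * r + 1) * h n +
          (r + 1) * (2 * r + 1) * |β n * x n ω| ^ (2 * r) * (h n ^ 2 * |b n ω|) := by ring
      _ ≤ (2 * r + 2) * (1 + |x n ω|) ^ (2 * r + 1) * h n +
          (r + 1) * (2 * r + 1) * (1 + |x n ω|) ^ (2 * r + 1) * h n := by gcongr
      _ = _ := by ring
  calc _ = |noiseCoeff r (β n) (h n) (b n ω) (x n ω)| ^ 2 := (sq_abs _).symm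
    _ ≤ (((2 * r + 2) + (r + 1) * (2 * r + 1)) * (1 + |x n ω|) ^ (2 * r + 1) * h n) ^ 2 := by
      gcongr
    _ = ((2 * r + 2) + (r + 1) * (2 * r + 1)) ^ 2 * h n ^ 2 * (1 + |x n ω|) ^ (4 * r + 2) := by
      rw [mul_pow, mul_pow, ← pow_mul, show (2 * r + 1) * 2 = 4 * r + 2 by ring]
      ring
    _ ≤ _ := by gcongr

theorem stronglyMeasurable_noiseCoeff (S : IsPerturbedRecursion P ℱ x ε b β h δ γ κ σ2)
    (r n : ℕ) : StronglyMeasurable[ℱ n] fun ω => noiseCoeff r (β n) (h n) (b n ω) (x n ω) := by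
  have hx := S.stronglyMeasurable n
  have hb := S.stronglyMeasurable_b n
  simp only [noiseCoeff]
  exact ((((hx.const_mul _).pow _).const_mul _).mul_const _).add
    (((((hx.const_mul _).pow _).const_mul _).mul_const _).mul hb)

theorem noiseCoeff_bounded (S : IsPerturbedRecursion P ℱ x ε b β h δ γ κ σ2) (r n : ℕ) :
    ∃ C, ∀ ω, |noiseCoeff r (β n) (h n) (b n ω) (x n ω)| ≤ C := by
  obtain ⟨B, hB⟩ := S.bounded n
  refine ⟨((2 * r + 2) + (r + 1) * (2 * r + 1)) ^ 2 * δ n * (1 + B) ^ (4 * r + 2) + 1,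
    fun ω => ?_⟩
  have h1 := S.noiseCoeff_sq_le r n ω
  have h2 : (1 + |x n ω|) ^ (4 * r + 2) ≤ (1 + B) ^ (4 * r + 2) :=
    pow_le_pow_left₀ (by positivity) (by linarith [hB ω]) _
  have h3 := mul_le_mul_of_nonneg_left h2
    (by have := S.δ_nonneg n; positivity :
      0 ≤ ((2 * r + 2 : ℝ) + (r + 1) * (2 * r + 1)) ^ 2 * δ n)
  have h4 := sq_abs (noiseCoeff r (β n) (h n) (b n ω) (x n ω))
  nlinarith [sq_nonneg (|noiseCoeff r (β n) (h n) (b n ω) (x n ω)| - 1)]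

/-! ### Uniform moment bounds. -/

variable [IsProbabilityMeasure P]

theorem integrable_pow (S : IsPerturbedRecursion P ℱ x ε b β h δ γ κ σ2) (n m : ℕ) :
    Integrable (fun ω => x n ω ^ m) P := by
  obtain ⟨C, hC⟩ := S.bounded n
  refine integrable_of_abs_le (ℱ.le n) ((S.stronglyMeasurable n).pow m) ⟨C ^ m, fun ω => ?_⟩
  rw [abs_pow]
  exact pow_le_pow_left₀ (abs_nonneg _) (hC ω) m

theorem integrable_one_add_abs_pow (S : IsPerturbedRecursion P ℱ x ε b β h δ γ κ σ2) (n m : ℕ) :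
    Integrable (fun ω => (1 + |x n ω|) ^ m) P := by
  obtain ⟨C, hC⟩ := S.bounded n
  refine integrable_of_abs_le (ℱ.le n)
    ((stronglyMeasurable_const.add (S.stronglyMeasurable n).norm).pow m)
    ⟨(1 + C) ^ m, fun ω => ?_⟩
  have : 0 ≤ 1 + |x n ω| := by positivity
  rw [abs_pow, abs_of_nonneg this]
  exact pow_le_pow_left₀ this (by linarith [hC ω]) m

theorem integrable_noiseCoeff_mul (S : IsPerturbedRecursion P ℱ x ε b β h δ γ κ σ2) (r n : ℕ) :
    Integrable (fun ω => noiseCoeff r (β n) (h n) (b n ω) (x n ω) * ε n ω) P :=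
  (integrable_of_abs_le (ℱ.le n) (S.stronglyMeasurable_noiseCoeff r n)
    (S.noiseCoeff_bounded r n)).mul_bdd (c := 1) (S.noise.integrable n).aestronglyMeasurable
    (Eventually.of_forall (S.noise.abs_le_one n))

/-- Induction on `r`: in the mean the noise vanishes and the increment estimate becomes a perturbed
affine contraction for the moment of order `2 * r + 2`, whose source term is the bounded moment of
order `2 * r`. -/
theorem exists_moment_le (S : IsPerturbedRecursion P ℱ x ε b β h δ γ κ σ2) (r : ℕ) :
    ∃ B, ∀ n, ∫ ω, x n ω ^ (2 * r) ∂P ≤ B := by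
  induction r with
  | zero => exact ⟨1, fun n => by simp⟩
  | succ r ih =>
    obtain ⟨B, hB⟩ := ih
    obtain ⟨C, hC, hs⟩ := S.exists_abs_incrementError_le r
    set D : ℝ := (r + 1) * (2 * r + 1) * |σ2| with hD
    have hD0 : 0 ≤ D := by positivity
    rw [show 2 * (r + 1) = 2 * r + 2 by ring]
    set M : ℝ := 2 ^ (2 * (r + 1) - 1) with hM
    have hM0 : 0 ≤ M := by positivity
    refine exists_bound_of_recursion (A := D * |B|) (C := C * M) (by positivity) (by positivity)
      S.δ_nonneg S.δ_le_one S.γ_nonneg S.summable_γ fun n => ?_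
    have hi1 := S.integrable_pow n (2 * r + 2)
    have hi2 := S.integrable_pow n (2 * r)
    have hi3 := S.integrable_noiseCoeff_mul r n
    have hγ := S.γ_nonneg n
    have hδ := S.δ_nonneg n
    have hpt : ∀ ω, x (n + 1) ω ^ (2 * r + 2) ≤ (1 - δ n) * x n ω ^ (2 * r + 2) +
        D * δ n * x n ω ^ (2 * r) + noiseCoeff r (β n) (h n) (b n ω) (x n ω) * ε n ω +
        C * M * γ n * (1 + x n ω ^ (2 * r + 2)) := by
      intro ω
      have h1 := (le_abs_self _).trans (hs n ω)
      have h2 := one_add_abs_pow_le (x n ω) (r + 1)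
      rw [show 2 * (r + 1) = 2 * r + 2 by ring] at h2
      have h3 := mul_le_mul_of_nonneg_left h2 (mul_nonneg hC hγ)
      have h4 : 0 ≤ x n ω ^ (2 * r + 2) := Even.pow_nonneg ⟨r + 1, by ring⟩ _
      have h5 : 0 ≤ x n ω ^ (2 * r) := (even_two_mul r).pow_nonneg _
      have h6 : (r + 1) * (2 * r + 1) * σ2 * (δ n * x n ω ^ (2 * r)) ≤
          D * δ n * x n ω ^ (2 * r) := by
        rw [hD, mul_assoc _ (δ n)]
        gcongr
        exact le_abs_self _
      -- Part of the drift is given away: `(r + 1) * δ n` may exceed `1`, while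
      -- `exists_bound_of_recursion` needs a nonnegative factor `1 - δ n`.
      have h7 : δ n * x n ω ^ (2 * r + 2) ≤ (r + 1) * δ n * x n ω ^ (2 * r + 2) := by
        have : (1 : ℝ) ≤ r + 1 := by linarith [Nat.cast_nonneg (α := ℝ) r]
        rw [mul_assoc]
        exact le_mul_of_one_le_left (by positivity) this
      rw [incrementError] at h1
      rw [show 2 * (r + 1) - 1 = 2 * r + 2 - 1 by omega] at hM
      rw [← hM] at h3
      linarith
    calc ∫ ω, x (n + 1) ω ^ (2 * r + 2) ∂P
        ≤ ∫ ω, ((1 - δ n) * x n ω ^ (2 * r + 2) + D * δ n * x n ω ^ (2 * r) +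
          noiseCoeff r (β n) (h n) (b n ω) (x n ω) * ε n ω +
          C * M * γ n * (1 + x n ω ^ (2 * r + 2))) ∂P := by
          refine integral_mono (S.integrable_pow _ _) ?_ hpt
          fun_prop
      _ = (1 - δ n) * ∫ ω, x n ω ^ (2 * r + 2) ∂P + D * δ n * ∫ ω, x n ω ^ (2 * r) ∂P + 0 +
          C * M * γ n * (1 + ∫ ω, x n ω ^ (2 * r + 2) ∂P) := by
          rw [integral_add (by fun_prop) (by fun_prop), integral_add (by fun_prop) (by fun_prop),
            integral_add (by fun_prop) (by fun_prop), integral_const_mul, integral_const_mul,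
            integral_const_mul, integral_add (by fun_prop) (by fun_prop),
            S.noise.integral_mul_eq_zero (S.stronglyMeasurable_noiseCoeff r n)
              (S.noiseCoeff_bounded r n)]
          simp
      _ ≤ _ := by
          have h1 := mul_le_mul_of_nonneg_left ((hB n).trans (le_abs_self B))
            (mul_nonneg hD0 hδ)
          linarith

theorem exists_one_add_abs_moment_le (S : IsPerturbedRecursion P ℱ x ε b β h δ γ κ σ2) (m : ℕ) :
    ∃ B, 0 ≤ B ∧ ∀ n, ∫ ω, (1 + |x n ω|) ^ m ∂P ≤ B := by
  obtain ⟨B, hB⟩ := S.exists_moment_le m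
  refine ⟨2 ^ (2 * m - 1) * (1 + |B|), by positivity, fun n => ?_⟩
  have hi := S.integrable_pow n (2 * m)
  calc ∫ ω, (1 + |x n ω|) ^ m ∂P ≤ ∫ ω, 2 ^ (2 * m - 1) * (1 + x n ω ^ (2 * m)) ∂P := by
        refine integral_mono (S.integrable_one_add_abs_pow n m) (by fun_prop) fun ω => ?_
        refine le_trans ?_ (one_add_abs_pow_le _ _)
        exact pow_le_pow_right₀ (by linarith [abs_nonneg (x n ω)]) (by omega)
    _ = 2 ^ (2 * m - 1) * (1 + ∫ ω, x n ω ^ (2 * m) ∂P) := by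
        rw [integral_const_mul, integral_add (by fun_prop) hi]
        simp
    _ ≤ _ := by
        gcongr
        exact (hB n).trans (le_abs_self B)

/-! ### Almost sure limits of weighted sums. -/

theorem ae_summable_mul_pow (S : IsPerturbedRecursion P ℱ x ε b β h δ γ κ σ2) {w : ℕ → ℝ}
    (hw : ∀ n, 0 ≤ w n) (hs : Summable w) (m i : ℕ) :
    ∀ᵐ ω ∂P, Summable fun n => w n * x (n + i) ω ^ (2 * m) := by
  obtain ⟨B, hB⟩ := S.exists_moment_le m
  refine ae_summable_of_summable_integral_abs
    (fun n => (S.integrable_pow (n + i) (2 * m)).const_mul _) ?_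
  refine Summable.of_nonneg_of_le (fun n => integral_nonneg fun ω => abs_nonneg _) (fun n => ?_)
    (hs.mul_right B)
  have h1 : ∀ ω, |w n * x (n + i) ω ^ (2 * m)| = w n * x (n + i) ω ^ (2 * m) := fun ω =>
    abs_of_nonneg (mul_nonneg (hw n) ((even_two_mul m).pow_nonneg _))
  simp_rw [h1]
  rw [integral_const_mul]
  exact mul_le_mul_of_nonneg_left (hB _) (hw n)

theorem ae_summable_incrementError (S : IsPerturbedRecursion P ℱ x ε b β h δ γ κ σ2) (r : ℕ) :
    ∀ᵐ ω ∂P, Summable fun n =>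
      incrementError r σ2 (δ n) (β n) (h n) (b n ω) (x n ω) (x (n + 1) ω) (ε n ω) := by
  obtain ⟨C, hC, hs⟩ := S.exists_abs_incrementError_le r
  obtain ⟨B, hB0, hB⟩ := S.exists_one_add_abs_moment_le (2 * r + 2)
  have hi : ∀ n, Integrable (fun ω =>
      incrementError r σ2 (δ n) (β n) (h n) (b n ω) (x n ω) (x (n + 1) ω) (ε n ω)) P := by
    intro n
    have h1 := S.integrable_pow n (2 * r + 2)
    have h2 := S.integrable_pow n (2 * r)
    have h3 := S.integrable_noiseCoeff_mul r n
    have h4 := S.integrable_pow (n + 1) (2 * r + 2)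
    simp only [incrementError]
    fun_prop
  refine ae_summable_of_summable_integral_abs hi ?_
  refine Summable.of_nonneg_of_le (fun n => integral_nonneg fun ω => abs_nonneg _) (fun n => ?_)
    ((S.summable_γ.mul_left C).mul_right B)
  have hγ := S.γ_nonneg n
  calc _ ≤ ∫ ω, C * γ n * (1 + |x n ω|) ^ (2 * r + 2) ∂P :=
        integral_mono (hi n).abs ((S.integrable_one_add_abs_pow n _).const_mul _) (hs n)
    _ ≤ _ := by
        rw [integral_const_mul]
        exact mul_le_mul_of_nonneg_left (hB n) (mul_nonneg hC hγ)

theorem ae_exists_tendsto_sum_noiseCoeff (S : IsPerturbedRecursion P ℱ x ε b β h δ γ κ σ2)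
    (r : ℕ) {w : ℕ → ℝ} (hs : Summable fun n => δ n * w n ^ 2) :
    ∀ᵐ ω ∂P, ∃ l, Tendsto (fun n => ∑ k ∈ Finset.range n,
      w k * noiseCoeff r (β k) (h k) (b k ω) (x k ω) * ε k ω) atTop (𝓝 l) := by
  obtain ⟨B, hB0, hB⟩ := S.exists_one_add_abs_moment_le (4 * r + 2)
  set D : ℝ := ((2 * r + 2) + (r + 1) * (2 * r + 1)) ^ 2 with hD
  have hm : ∀ n, StronglyMeasurable[ℱ n]
      fun ω => w n * noiseCoeff r (β n) (h n) (b n ω) (x n ω) :=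
    fun n => (S.stronglyMeasurable_noiseCoeff r n).const_mul _
  have hb : ∀ n, ∃ C, ∀ ω, |w n * noiseCoeff r (β n) (h n) (b n ω) (x n ω)| ≤ C := by
    intro n
    obtain ⟨C, hC⟩ := S.noiseCoeff_bounded r n
    refine ⟨|w n| * C, fun ω => ?_⟩
    rw [abs_mul]
    exact mul_le_mul_of_nonneg_left (hC ω) (abs_nonneg _)
  refine S.noise.ae_exists_tendsto_sum_mul hm hb ?_
  refine Summable.of_nonneg_of_le (fun n => integral_nonneg fun ω => sq_nonneg _) (fun n => ?_)
    ((hs.mul_left D).mul_right B)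
  have hδ := S.δ_nonneg n
  calc _ ≤ ∫ ω, D * (δ n * w n ^ 2) * (1 + |x n ω|) ^ (4 * r + 2) ∂P := by
        refine integral_mono_of_nonneg (Eventually.of_forall fun ω => sq_nonneg _)
          ((S.integrable_one_add_abs_pow n _).const_mul _) (Eventually.of_forall fun ω => ?_)
        have := mul_le_mul_of_nonneg_left (S.noiseCoeff_sq_le r n ω) (sq_nonneg (w n))
        simp only [mul_pow]
        linarith
    _ ≤ _ := by
        rw [integral_const_mul]
        exact mul_le_mul_of_nonneg_left (hB n) (by positivity)

/-- With `D ^ 2` in the denominator all terms are summable, because `∑ δ / D ^ 2 < ∞`. Writing the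
increment of `x ^ m / D ^ 2` as `(x' ^ m - x ^ m) / D ^ 2 - x' ^ m * (1 / D ^ 2 - 1 / D' ^ 2)`, with
primes for the next time, shows that the sequence converges. Its limit is `0` since `∑ δ * (x ^ m /
D ^ 2)` converges while `∑ δ` does not. -/
theorem ae_tendsto_pow_div_sq (S : IsPerturbedRecursion P ℱ x ε b β h δ γ κ σ2) (r : ℕ) :
    ∀ᵐ ω ∂P, Tendsto (fun n => x n ω ^ (2 * r + 2) / cumWeight δ n ^ 2) atTop (𝓝 0) := by
  set D := cumWeight δ with hD
  have hD1 : ∀ n, 1 ≤ D n := one_le_cumWeight S.δ_nonneg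
  have hDδ : Summable fun n => δ n / D n ^ 2 := summable_div_sq_cumWeight S.δ_nonneg S.δ_le_one
  have hDδ0 : ∀ n, 0 ≤ δ n / D n ^ 2 := fun n => div_nonneg (S.δ_nonneg n) (sq_nonneg _)
  have hDD0 : ∀ n, 0 ≤ 1 / D n ^ 2 - 1 / D (n + 1) ^ 2 := fun n => by
    have h1 := hD1 n
    have h2 := cumWeight_mono S.δ_nonneg n.le_succ
    rw [sub_nonneg]
    gcongr
  have hDw : Summable fun n => δ n * (1 / D n ^ 2) ^ 2 := by
    refine Summable.of_nonneg_of_le (fun n => mul_nonneg (S.δ_nonneg n) (sq_nonneg _))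
      (fun n => ?_) hDδ
    rw [div_eq_mul_one_div (δ n)]
    refine mul_le_mul_of_nonneg_left ?_ (S.δ_nonneg n)
    have h1 : 1 / D n ^ 2 ≤ 1 := by
      rw [div_le_one (by have := hD1 n; positivity)]
      exact one_le_pow₀ (hD1 n)
    have h2 : 0 ≤ 1 / D n ^ 2 := by positivity
    nlinarith
  filter_upwards [S.ae_summable_incrementError r, S.ae_summable_mul_pow hDδ0 hDδ (r + 1) 0,
    S.ae_summable_mul_pow hDδ0 hDδ r 0,
    S.ae_summable_mul_pow hDD0 (summable_sub_inv_sq_cumWeight S.δ_nonneg) (r + 1) 1,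
    S.ae_exists_tendsto_sum_noiseCoeff r hDw] with ω h1 h2 h3 h4 ⟨l, h5⟩
  rw [show 2 * (r + 1) = 2 * r + 2 by ring] at h2 h4
  simp only [add_zero] at h2 h3
  set s : ℕ → ℝ := fun n =>
    incrementError r σ2 (δ n) (β n) (h n) (b n ω) (x n ω) (x (n + 1) ω) (ε n ω) with hs
  have h1' : Summable fun n => s n / D n ^ 2 := by
    refine Summable.of_norm_bounded h1.norm fun n => ?_
    rw [norm_div]
    refine div_le_self (norm_nonneg _) ?_
    rw [Real.norm_of_nonneg (sq_nonneg _)]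
    exact one_le_pow₀ (hD1 n)
  have hsum := (((h1'.sub (h2.mul_left (r + 1 : ℝ))).add
    (h3.mul_left ((r + 1) * (2 * r + 1) * σ2))).sub h4).tendsto_sum_tsum_nat.add h5
  refine tendsto_zero_of_summable_mul S.δ_nonneg S.not_summable_δ
    (l := _ + x 0 ω ^ (2 * r + 2) / D 0 ^ 2) ?_ ((hsum.add_const _).congr fun n => ?_)
  · refine h2.congr fun n => ?_
    ring
  · rw [← Finset.sum_add_distrib, ← sub_add_cancel (x n ω ^ (2 * r + 2) / D n ^ 2)
      (x 0 ω ^ (2 * r + 2) / D 0 ^ 2), ← Finset.sum_range_sub fun n =>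
      x n ω ^ (2 * r + 2) / D n ^ 2]
    congr 1
    refine Finset.sum_congr rfl fun k _ => ?_
    simp only [hs, incrementError]
    ring

/-- The previous result for the doubled exponent `2 * (2 * r + 2)`, followed by a square root,
lowers `D ^ 2` to `D`. -/
theorem ae_tendsto_pow_div (S : IsPerturbedRecursion P ℱ x ε b β h δ γ κ σ2) (r : ℕ) :
    ∀ᵐ ω ∂P, Tendsto (fun n => x n ω ^ (2 * r + 2) / cumWeight δ n) atTop (𝓝 0) := by
  filter_upwards [S.ae_tendsto_pow_div_sq (2 * r + 1)] with ω hω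
  have h1 := hω.sqrt
  rw [Real.sqrt_zero] at h1
  refine h1.congr fun n => ?_
  rw [show x n ω ^ (2 * (2 * r + 1) + 2) / cumWeight δ n ^ 2
    = (x n ω ^ (2 * r + 2) / cumWeight δ n) ^ 2 by rw [div_pow]; ring]
  refine Real.sqrt_sq (div_nonneg ?_ (cumWeight_pos S.δ_nonneg n).le)
  exact Even.pow_nonneg ⟨r + 1, by ring⟩ _

/-- The weighted averages of the even powers of `x` converge to the even moments of a centred
Gaussian variable with variance `σ2`. -/
theorem ae_tendsto_weighted_sum (S : IsPerturbedRecursion P ℱ x ε b β h δ γ κ σ2) (r : ℕ) :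
    ∀ᵐ ω ∂P, Tendsto
      (fun n => (∑ k ∈ Finset.range n, δ k * x k ω ^ (2 * r)) / cumWeight δ n) atTop
      (𝓝 (σ2 ^ r * (Nat.factorial (2 * r) : ℝ) / (2 ^ r * (Nat.factorial r : ℝ)))) := by
  set D := cumWeight δ with hD
  have hDpos : ∀ n, 0 < D n := cumWeight_pos S.δ_nonneg
  have hDtop : Tendsto D atTop atTop := tendsto_cumWeight_atTop S.δ_nonneg S.not_summable_δ
  induction r with
  | zero =>
    refine Eventually.of_forall fun ω => ?_
    have h1 : Tendsto (fun n => 1 - 1 / D n) atTop (𝓝 (1 - 0)) :=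
      (hDtop.const_div_atTop 1).const_sub 1
    simp only [mul_zero, pow_zero, mul_one, Nat.factorial_zero, Nat.cast_one, div_one]
    rw [sub_zero] at h1
    refine h1.congr fun n => ?_
    rw [one_sub_div (hDpos n).ne']
    congr 1
    simp [hD, cumWeight]
  | succ r ih =>
    have hDw : Summable fun n => δ n * (1 / D n) ^ 2 := by
      refine (summable_div_sq_cumWeight S.δ_nonneg S.δ_le_one).congr fun n => ?_
      rw [div_pow, one_pow, mul_one_div]
    filter_upwards [ih, S.ae_summable_incrementError r, S.ae_tendsto_pow_div r,
      S.ae_exists_tendsto_sum_noiseCoeff r hDw] with ω h1 h2 h3 ⟨l, h4⟩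
    have h4' := tendsto_weighted_sum_div (cumWeight_mono S.δ_nonneg) hDpos hDtop h4
    have h2' := h2.tendsto_sum_tsum_nat.div_atTop hDtop
    have h5 := hDtop.const_div_atTop (x 0 ω ^ (2 * r + 2))
    have hr : (r + 1 : ℝ) ≠ 0 := by positivity
    -- In order: induction hypothesis, noise (by Kronecker), summable errors, and the two boundary
    -- terms of the telescoping sum.
    have h6 := (((((h1.const_mul ((r + 1) * (2 * r + 1) * σ2)).add h4').add h2').sub h3).add
      h5).div_const (r + 1 : ℝ)
    have hlim : ((r + 1) * (2 * r + 1) * σ2 * (σ2 ^ r * (Nat.factorial (2 * r) : ℝ) /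
        (2 ^ r * (Nat.factorial r : ℝ))) + 0 + 0 - 0 + 0) / (r + 1) =
        σ2 ^ (r + 1) * (Nat.factorial (2 * (r + 1)) : ℝ) /
          (2 ^ (r + 1) * (Nat.factorial (r + 1) : ℝ)) := by
      rw [show 2 * (r + 1) = 2 * r + 1 + 1 by ring, Nat.factorial_succ, Nat.factorial_succ,
        Nat.factorial_succ]
      have := Nat.cast_ne_zero (R := ℝ).2 (Nat.factorial_ne_zero r)
      push_cast
      field_simp
      ring
    rw [hlim] at h6
    refine h6.congr fun n => ?_
    have htel := Finset.sum_range_sub (fun n => x n ω ^ (2 * r + 2)) n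
    have hterm : ∑ k ∈ Finset.range n, (x (k + 1) ω ^ (2 * r + 2) - x k ω ^ (2 * r + 2)) =
        -(r + 1) * ∑ k ∈ Finset.range n, δ k * x k ω ^ (2 * (r + 1)) +
        (r + 1) * (2 * r + 1) * σ2 * ∑ k ∈ Finset.range n, δ k * x k ω ^ (2 * r) +
        ∑ k ∈ Finset.range n,
          D k * (1 / D k * noiseCoeff r (β k) (h k) (b k ω) (x k ω) * ε k ω) +
        ∑ k ∈ Finset.range n,
          incrementError r σ2 (δ k) (β k) (h k) (b k ω) (x k ω) (x (k + 1) ω) (ε k ω) := by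
      rw [Finset.mul_sum, Finset.mul_sum, ← Finset.sum_add_distrib, ← Finset.sum_add_distrib,
        ← Finset.sum_add_distrib]
      refine Finset.sum_congr rfl fun k _ => ?_
      have := (hDpos k).ne'
      have h7 : D k * (1 / D k * noiseCoeff r (β k) (h k) (b k ω) (x k ω) * ε k ω)
          = noiseCoeff r (β k) (h k) (b k ω) (x k ω) * ε k ω := by
        field_simp
      rw [h7, incrementError]
      ring
    rw [htel] at hterm
    have hsolve : ∑ k ∈ Finset.range n, δ k * x k ω ^ (2 * (r + 1)) =
        ((r + 1) * (2 * r + 1) * σ2 * ∑ k ∈ Finset.range n, δ k * x k ω ^ (2 * r) +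
        ∑ k ∈ Finset.range n,
          D k * (1 / D k * noiseCoeff r (β k) (h k) (b k ω) (x k ω) * ε k ω) +
        ∑ k ∈ Finset.range n,
          incrementError r σ2 (δ k) (β k) (h k) (b k ω) (x k ω) (x (k + 1) ω) (ε k ω) -
          x n ω ^ (2 * r + 2) + x 0 ω ^ (2 * r + 2)) / (r + 1) := by
      rw [eq_div_iff hr]
      linarith
    rw [hsolve]
    ring

end IsPerturbedRecursion

/-! ### The weights `1 / (n log n)` and `log log n`. -/

/-- The weights `1 / (n log n)` of the logarithmic averages. -/
noncomputable def logWeight (n : ℕ) : ℝ := 1 / ((n : ℝ) * Real.log n)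

theorem half_le_log {n : ℕ} (hn : 2 ≤ n) : 1 / 2 ≤ Real.log n := by
  have h1 : Real.log 2 ≤ Real.log n := Real.log_le_log (by norm_num) (by exact_mod_cast hn)
  linarith [Real.log_two_gt_d9]

theorem one_le_mul_log {n : ℕ} (hn : 2 ≤ n) : 1 ≤ (n : ℝ) * Real.log n := by
  have h1 := half_le_log hn
  have h2 : (2 : ℝ) ≤ n := by exact_mod_cast hn
  nlinarith

theorem logWeight_nonneg (n : ℕ) : 0 ≤ logWeight n :=
  div_nonneg zero_le_one (mul_nonneg n.cast_nonneg (Real.log_natCast_nonneg n))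

theorem logWeight_le_one {n : ℕ} (hn : 2 ≤ n) : logWeight n ≤ 1 := by
  have h1 := one_le_mul_log hn
  rw [logWeight, div_le_one (by linarith)]
  exact h1

theorem log_succ_sub_log_le {n : ℕ} (hn : 2 ≤ n) :
    Real.log (n + 1 : ℕ) - Real.log n ≤ 1 / n := by
  have h2 : (2 : ℝ) ≤ n := by exact_mod_cast hn
  rw [← Real.log_div (by positivity) (by positivity)]
  refine (Real.log_le_sub_one_of_pos (by positivity)).trans_eq ?_
  push_cast
  field_simp
  ring

theorem le_log_succ_sub_log {n : ℕ} (hn : 2 ≤ n) :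
    1 / ((n : ℝ) + 1) ≤ Real.log (n + 1 : ℕ) - Real.log n := by
  have h2 : (2 : ℝ) ≤ n := by exact_mod_cast hn
  rw [← Real.log_div (by positivity) (by positivity)]
  refine le_trans (le_of_eq ?_) (Real.one_sub_inv_le_log_of_pos (by positivity))
  push_cast
  field_simp
  ring

/-- The relative increment of the logarithm lies between consecutive weights. -/
theorem logWeight_succ_le {n : ℕ} (hn : 2 ≤ n) :
    logWeight (n + 1) ≤ 1 - Real.log n / Real.log (n + 1 : ℕ) := by
  have h1 := half_le_log (hn.trans n.le_succ)
  have h2 : (2 : ℝ) ≤ n := by exact_mod_cast hn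
  have h3 := le_log_succ_sub_log hn
  have h4 : logWeight (n + 1) = 1 / ((n : ℝ) + 1) / Real.log (n + 1 : ℕ) := by
    rw [logWeight, div_div]
    push_cast
    rfl
  rw [h4, one_sub_div (by linarith)]
  gcongr

theorem one_sub_log_div_le {n : ℕ} (hn : 2 ≤ n) :
    1 - Real.log n / Real.log (n + 1 : ℕ) ≤ logWeight n := by
  have h0 := half_le_log hn
  have h1 := half_le_log (hn.trans n.le_succ)
  have h2 : (2 : ℝ) ≤ n := by exact_mod_cast hn
  have h3 := log_succ_sub_log_le hn
  have h5 : Real.log n ≤ Real.log (n + 1 : ℕ) :=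
    Real.log_le_log (by positivity) (by exact_mod_cast n.le_succ)
  rw [one_sub_div (by linarith), logWeight, ← div_div]
  gcongr

theorem logWeight_antitone {n : ℕ} (hn : 2 ≤ n) : logWeight (n + 1) ≤ logWeight n :=
  (logWeight_succ_le hn).trans (one_sub_log_div_le hn)

theorem loglog_succ_sub_le {n : ℕ} (hn : 2 ≤ n) :
    Real.log (Real.log (n + 1 : ℕ)) - Real.log (Real.log n) ≤ logWeight n := by
  have h0 := half_le_log hn
  have h1 := half_le_log (hn.trans n.le_succ)
  have h2 : (2 : ℝ) ≤ n := by exact_mod_cast hn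
  have h3 := log_succ_sub_log_le hn
  rw [← Real.log_div (by linarith) (by linarith)]
  refine (Real.log_le_sub_one_of_pos (div_pos (by linarith) (by linarith))).trans ?_
  rw [div_sub_one (by linarith), logWeight, ← div_div]
  gcongr

theorem logWeight_succ_le_loglog {n : ℕ} (hn : 2 ≤ n) :
    logWeight (n + 1) ≤ Real.log (Real.log (n + 1 : ℕ)) - Real.log (Real.log n) := by
  have h0 := half_le_log hn
  have h1 := half_le_log (hn.trans n.le_succ)
  rw [← Real.log_div (by linarith) (by linarith)]
  refine (logWeight_succ_le hn).trans
    (le_trans (le_of_eq ?_) (Real.one_sub_inv_le_log_of_pos (div_pos (by linarith) (by linarith))))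
  rw [inv_div]

theorem tendsto_loglog : Tendsto (fun n : ℕ => Real.log (Real.log (n : ℝ))) atTop atTop :=
  Real.tendsto_log_atTop.comp (Real.tendsto_log_atTop.comp tendsto_natCast_atTop_atTop)

theorem loglog_le_sum_logWeight (n : ℕ) :
    Real.log (Real.log (n + 2 : ℕ)) - Real.log (Real.log 2) ≤
      ∑ k ∈ Finset.range n, logWeight (k + 2) := by
  induction n with
  | zero => simp
  | succ n ih =>
    rw [Finset.sum_range_succ]
    have := loglog_succ_sub_le (show 2 ≤ n + 2 by omega)
    rw [show n + 1 + 2 = n + 2 + 1 by ring]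
    linarith

theorem sum_logWeight_le (n : ℕ) :
    ∑ k ∈ Finset.range (n + 1), logWeight (k + 2) ≤
      logWeight 2 + (Real.log (Real.log (n + 2 : ℕ)) - Real.log (Real.log 2)) := by
  induction n with
  | zero => simp
  | succ n ih =>
    rw [Finset.sum_range_succ]
    have := logWeight_succ_le_loglog (show 2 ≤ n + 2 by omega)
    rw [show n + 1 + 2 = n + 2 + 1 by ring]
    linarith

theorem not_summable_logWeight : ¬ Summable fun k => logWeight (k + 2) := by
  rw [not_summable_iff_tendsto_nat_atTop_of_nonneg fun k => logWeight_nonneg _]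
  refine tendsto_atTop_mono loglog_le_sum_logWeight ?_
  exact tendsto_atTop_add_const_right _ _ (tendsto_loglog.comp (tendsto_add_atTop_nat 2))

/-- Both quantities differ by a bounded amount. The `n + 1` weights are those at times `2, …, n +
2`, matching `log log (n + 2)`. -/
theorem tendsto_cumWeight_div_loglog :
    Tendsto (fun n : ℕ => cumWeight (fun k => logWeight (k + 2)) (n + 1) /
      Real.log (Real.log (n + 2 : ℕ))) atTop (𝓝 1) := by
  have hll : Tendsto (fun n : ℕ => Real.log (Real.log (n + 2 : ℕ))) atTop atTop :=
    tendsto_loglog.comp (tendsto_add_atTop_nat 2)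
  set a : ℝ := 1 - Real.log (Real.log 2) with ha
  have hlow : Tendsto (fun n : ℕ => 1 + a / Real.log (Real.log (n + 2 : ℕ))) atTop (𝓝 1) := by
    simpa using (hll.const_div_atTop a).const_add 1
  have hup : Tendsto (fun n : ℕ => 1 + (a + logWeight 2) / Real.log (Real.log (n + 2 : ℕ)))
      atTop (𝓝 1) := by
    simpa using (hll.const_div_atTop (a + logWeight 2)).const_add 1
  refine tendsto_of_tendsto_of_tendsto_of_le_of_le' hlow hup ?_ ?_
  · filter_upwards [hll.eventually_gt_atTop 0] with n hn
    rw [← div_self hn.ne', ← add_div]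
    refine div_le_div_of_nonneg_right ?_ hn.le
    have h1 := loglog_le_sum_logWeight n
    have h2 := logWeight_nonneg (n + 2)
    rw [cumWeight, Finset.sum_range_succ]
    linarith
  · filter_upwards [hll.eventually_gt_atTop 0] with n hn
    rw [← div_self hn.ne', ← add_div]
    refine div_le_div_of_nonneg_right ?_ hn.le
    have h1 := sum_logWeight_le n
    rw [cumWeight]
    linarith

/-! ### Coefficients of the rescaled recursion. -/

/-- The scale `√(n log n)` of the fluctuations. -/
noncomputable def scale (n : ℕ) : ℝ := √((n : ℝ) * Real.log n)

theorem scale_pos {n : ℕ} (hn : 2 ≤ n) : 0 < scale n :=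
  Real.sqrt_pos.2 (one_pos.trans_le (one_le_mul_log hn))

theorem scale_sq {n : ℕ} (hn : 2 ≤ n) : scale n ^ 2 = n * Real.log n :=
  Real.sq_sqrt (zero_le_one.trans (one_le_mul_log hn))

theorem inv_scale_sq {n : ℕ} (hn : 2 ≤ n) : (1 / scale n) ^ 2 = logWeight n := by
  rw [div_pow, one_pow, scale_sq hn, logWeight]

/-- The contraction factor of the rescaled walk. -/
noncomputable def contraction (n : ℕ) : ℝ := (1 + 1 / (2 * (n : ℝ))) * scale n / scale (n + 1)

theorem contraction_nonneg {n : ℕ} (hn : 2 ≤ n) : 0 ≤ contraction n :=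
  div_nonneg (mul_nonneg (by positivity) (scale_pos hn).le) (scale_pos (hn.trans n.le_succ)).le

/-- Criticality of `α = 1 / 2`: since `(n + 1 / 2) ^ 2 = n * (n + 1) + 1 / 4`, the polynomial
factors cancel up to order `1 / n ^ 2`, and the contraction comes from the logarithms alone. -/
theorem contraction_sq {n : ℕ} (hn : 2 ≤ n) : contraction n ^ 2 =
    (1 + 1 / (4 * n * (n + 1))) * (Real.log n / Real.log (n + 1 : ℕ)) := by
  have h1 := half_le_log (hn.trans n.le_succ)
  have h2 : (2 : ℝ) ≤ n := by exact_mod_cast hn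
  have h3 : Real.log (n + 1 : ℕ) ≠ 0 := by linarith
  rw [contraction, div_pow, mul_pow, scale_sq hn, scale_sq (hn.trans n.le_succ)]
  push_cast at h3 ⊢
  field_simp
  ring

theorem contraction_le_one {n : ℕ} (hn : 2 ≤ n) : contraction n ≤ 1 := by
  rw [← sq_le_one_iff₀ (contraction_nonneg hn), contraction_sq hn]
  have h1 := half_le_log (hn.trans n.le_succ)
  have h2 : (2 : ℝ) ≤ n := by exact_mod_cast hn
  have h3 := logWeight_succ_le hn
  -- The excess of order `1 / n ^ 2` is beaten by the logarithmic decrease, as `log (n + 1) ≤ n`.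
  have h4 : 1 / (4 * (n : ℝ) * (n + 1)) ≤ logWeight (n + 1) := by
    rw [logWeight]
    refine one_div_le_one_div_of_le (by positivity) ?_
    have h5 : Real.log (n + 1 : ℕ) ≤ n :=
      (Real.log_le_sub_one_of_pos (by positivity)).trans_eq (by push_cast; ring)
    have h6 := mul_le_mul_of_nonneg_left h5 (by positivity : (0 : ℝ) ≤ n + 1)
    push_cast at h6 ⊢
    nlinarith
  have h7 : 0 ≤ 1 / (4 * (n : ℝ) * (n + 1)) := by positivity
  nlinarith

/-- The decrease `1 - log n / log (n + 1)` lies between consecutive weights, so replacing it by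
`logWeight n` costs a telescoping difference. -/
theorem abs_contraction_sq_le {n : ℕ} (hn : 2 ≤ n) :
    |contraction n ^ 2 - 1 + logWeight n| ≤
      logWeight n - logWeight (n + 1) + 1 / (n * √(n : ℝ)) := by
  rw [contraction_sq hn]
  have h2 : (2 : ℝ) ≤ n := by exact_mod_cast hn
  have h3 := logWeight_succ_le hn
  have h4 := one_sub_log_div_le hn
  have h5 : 1 / (4 * (n : ℝ) * (n + 1)) ≤ 1 / (n * √(n : ℝ)) := by
    refine one_div_le_one_div_of_le (by positivity) ?_
    have : √(n : ℝ) ≤ n := by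
      rw [Real.sqrt_le_left (by positivity)]
      nlinarith
    nlinarith
  have h6 : 0 ≤ Real.log n / Real.log (n + 1 : ℕ) :=
    div_nonneg (Real.log_natCast_nonneg _) (Real.log_natCast_nonneg _)
  have h7 : 0 ≤ 1 / (4 * (n : ℝ) * (n + 1)) := by positivity
  have h8 := logWeight_nonneg (n + 1)
  generalize Real.log n / Real.log (n + 1 : ℕ) = u at *
  generalize 1 / (4 * (n : ℝ) * (n + 1)) = a at *
  have h9 : u ≤ 1 := by linarith
  have h10 : a * u ≤ a := mul_le_of_le_one_right h7 h9
  have h11 : 0 ≤ a * u := mul_nonneg h7 h6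
  rw [abs_le]
  constructor <;> nlinarith

theorem logWeight_sq_le {n : ℕ} (hn : 2 ≤ n) : logWeight n ^ 2 ≤ 4 * (1 / (n * √(n : ℝ))) := by
  have h1 := half_le_log hn
  have h2 : (2 : ℝ) ≤ n := by exact_mod_cast hn
  have h3 : √(n : ℝ) ≤ n := by
    rw [Real.sqrt_le_left (by positivity)]
    nlinarith
  rw [logWeight, div_pow, mul_one_div, one_pow, div_le_div_iff₀ (by positivity) (by positivity),
    mul_pow]
  have h4 : 1 / 4 ≤ Real.log n ^ 2 := by nlinarith
  have h5 := mul_le_mul_of_nonneg_left h4 (sq_nonneg (n : ℝ))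
  nlinarith

theorem inv_scale_succ_cube_le {n : ℕ} (hn : 2 ≤ n) :
    (1 / scale (n + 1)) ^ 3 ≤ 1 / (n * √(n : ℝ)) := by
  have h2 : (2 : ℝ) ≤ n := by exact_mod_cast hn
  have h1 : √(n : ℝ) ≤ scale (n + 1) := by
    refine Real.sqrt_le_sqrt ?_
    -- Here `n + 1 ≥ 3 > e`.
    have h3 : 1 ≤ Real.log (n + 1 : ℕ) := by
      rw [Real.le_log_iff_exp_le (by positivity)]
      push_cast
      linarith [Real.exp_one_lt_three]
    push_cast at h3 ⊢
    nlinarith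
  have h4 : (n : ℝ) * √(n : ℝ) = √(n : ℝ) ^ 3 := by
    rw [pow_succ, Real.sq_sqrt (by positivity)]
  rw [h4, div_pow, one_pow]
  gcongr

theorem logWeight_mul_scale_div_le {n : ℕ} (hn : 2 ≤ n) :
    logWeight n * (scale n / n) ≤ 4 * (1 / (n * √(n : ℝ))) := by
  have h1 := half_le_log hn
  have h2 : (2 : ℝ) ≤ n := by exact_mod_cast hn
  have h3 := scale_pos hn
  have h4 : logWeight n * (scale n / n) = 1 / (n * scale n) := by
    rw [logWeight, ← scale_sq hn]
    field_simp
  have h5 : √(n : ℝ) / 4 ≤ scale n := by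
    rw [scale]
    refine Real.le_sqrt_of_sq_le ?_
    rw [div_pow, Real.sq_sqrt (by positivity)]
    nlinarith
  rw [h4, mul_one_div, div_le_div_iff₀ (by positivity) (by positivity)]
  have := mul_le_mul_of_nonneg_left h5 (by positivity : (0 : ℝ) ≤ n)
  nlinarith

/-- The summable error bound in the recursion of the rescaled walk. -/
noncomputable def errorBound (n : ℕ) : ℝ :=
  logWeight n - logWeight (n + 1) + 4 * (1 / (n * √(n : ℝ)))

theorem summable_errorBound : Summable fun k => errorBound (k + 2) := by
  refine Summable.add ?_ (Summable.mul_left _ ?_)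
  · refine summable_of_sum_range_le (c := logWeight 2)
      (fun k => sub_nonneg.2 (logWeight_antitone (by omega))) fun n => ?_
    have := Finset.sum_range_sub' (fun k => logWeight (k + 2)) n
    simp only [show ∀ k, k + 1 + 2 = k + 2 + 1 from fun k => by ring] at this
    rw [this]
    have := logWeight_nonneg (n + 2)
    simp only [zero_add]
    linarith
  · have h1 : Summable fun n : ℕ => 1 / ((n : ℝ) * √(n : ℝ)) := by
      refine (Real.summable_one_div_nat_rpow.2 (by norm_num : (1 : ℝ) < 3 / 2)).congr fun n => ?_
      rw [Real.sqrt_eq_rpow, show (3 / 2 : ℝ) = 1 + 1 / 2 by norm_num,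
        Real.rpow_add_of_nonneg n.cast_nonneg (by norm_num) (by norm_num), Real.rpow_one]
    exact (summable_nat_add_iff 2).2 h1

/-! ### The conditional law of the steps. -/

theorem history_mono {Ω : Type*} (X : ℕ → Ω → ℝ) : Monotone (history X) := fun _ _ h =>
  biSup_mono fun _ hk => ⟨hk.1, hk.2.trans h⟩

theorem measurable_history {Ω : Type*} (X : ℕ → Ω → ℝ) {k n : ℕ} (hk : 1 ≤ k) (hkn : k ≤ n) :
    Measurable[history X n] (X k) :=
  Measurable.mono (comap_measurable (X k))
    (le_iSup₂_of_le (f := fun k (_ : k ∈ Set.Icc 1 n) =>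
      MeasurableSpace.comap (X k) inferInstance) k ⟨hk, hkn⟩ le_rfl) le_rfl

theorem measurable_position {Ω : Type*} (X : ℕ → Ω → ℝ) (n : ℕ) :
    Measurable[history X n] (position X n) :=
  Finset.measurable_fun_sum _ fun _ hk =>
    measurable_history X (Finset.mem_Icc.1 hk).1 (Finset.mem_Icc.1 hk).2

theorem position_succ {Ω : Type*} (X : ℕ → Ω → ℝ) (n : ℕ) (ω : Ω) :
    position X (n + 1) ω = position X n ω + X (n + 1) ω :=
  Finset.sum_Icc_succ_top (by omega) _

/-- The probability that the next step is `1`, given the first `n` steps. -/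
noncomputable def stepProb {Ω : Type*} (p q : ℝ) (X : ℕ → Ω → ℝ) (n : ℕ) (ω : Ω) : ℝ :=
  q + (p - q) * (position X n ω / n)

theorem measurable_stepProb {Ω : Type*} (p q : ℝ) (X : ℕ → Ω → ℝ) (n : ℕ) :
    Measurable[history X n] (stepProb p q X n) :=
  (((measurable_position X n).div_const _).const_mul _).const_add _

namespace IsMRW

variable {Ω : Type*} [m0 : MeasurableSpace Ω] {P : Measure Ω} {s p q : ℝ}
  {X : ℕ → Ω → ℝ} {K : ℕ → Ω → ℕ}

theorem history_le (hX : IsMRW P s p q X K) (n : ℕ) : history X n ≤ m0 :=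
  iSup₂_le fun k hk => (hX.measurable_step k hk.1).comap_le

theorem abs_step_le (hX : IsMRW P s p q X K) {n : ℕ} (hn : 1 ≤ n) (ω : Ω) : |X n ω| ≤ 1 := by
  rcases hX.step_mem n hn ω with h | h <;> simp [h]

theorem step_nonneg (hX : IsMRW P s p q X K) {n : ℕ} (hn : 1 ≤ n) (ω : Ω) : 0 ≤ X n ω := by
  rcases hX.step_mem n hn ω with h | h <;> simp [h]

theorem position_nonneg (hX : IsMRW P s p q X K) (n : ℕ) (ω : Ω) : 0 ≤ position X n ω :=
  Finset.sum_nonneg fun _ hk => hX.step_nonneg (Finset.mem_Icc.1 hk).1 ω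

theorem position_le (hX : IsMRW P s p q X K) (n : ℕ) (ω : Ω) : position X n ω ≤ n := by
  calc position X n ω ≤ ∑ _k ∈ Finset.Icc 1 n, (1 : ℝ) := Finset.sum_le_sum fun k hk =>
        (le_abs_self _).trans (hX.abs_step_le (Finset.mem_Icc.1 hk).1 ω)
    _ = n := by simp

/-- Given the first `n` steps, step `n + 1` is Bernoulli with parameter `stepProb p q X n`. -/
theorem condExp_step [IsProbabilityMeasure P] (hX : IsMRW P s p q X K) {n : ℕ} (hn : 1 ≤ n) :
    P[X (n + 1) | history X n] =ᵐ[P] stepProb p q X n := by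
  have hK := hX.measurable_recall (n + 1) (by omega)
  have hle := hX.history_le n
  have hsup : history X n ⊔ MeasurableSpace.comap (K (n + 1)) inferInstance ≤ m0 :=
    sup_le hle hK.comap_le
  have hind : ({ω | X (n + 1) ω = 1}.indicator fun _ => (1 : ℝ)) = X (n + 1) := by
    funext ω
    rcases hX.step_mem (n + 1) (by omega) ω with h | h <;> simp [Set.indicator, h]
  -- Splitting over the recalled time turns the random index into a finite sum: each `I k` is
  -- independent of the history with mean `1 / n`, and its cofactor is known from the history.
  set I : ℕ → Ω → ℝ := fun k => (K (n + 1) ⁻¹' {k}).indicator fun _ => (1 : ℝ) with hI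
  have hImeas : ∀ k, StronglyMeasurable[MeasurableSpace.comap (K (n + 1)) inferInstance] (I k) :=
    fun k => stronglyMeasurable_const.indicator ⟨{k}, MeasurableSet.singleton k, rfl⟩
  have hIint : ∀ k, Integrable (I k) P := fun k =>
    (integrable_const 1).indicator (hK (MeasurableSet.singleton k))
  have hstep : P[X (n + 1) | history X n ⊔ MeasurableSpace.comap (K (n + 1)) inferInstance]
      =ᵐ[P] ∑ k ∈ Finset.Icc 1 n, (fun ω => q + (p - q) * X k ω) * I k := by
    have h1 := hX.step_law n hn
    rw [hind] at h1
    refine h1.trans (Eventually.of_forall fun ω => ?_)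
    have hmem := hX.recall_mem n hn ω
    simp only [Finset.sum_apply, Pi.mul_apply]
    rw [Finset.sum_eq_single_of_mem _ hmem fun k _ hk => by simp [hI, hk.symm]]
    rcases hX.step_mem (K (n + 1) ω) (Finset.mem_Icc.1 hmem).1 ω with h | h <;> simp [hI, h]
  have hfm : ∀ k ∈ Finset.Icc 1 n, StronglyMeasurable[history X n]
      fun ω => q + (p - q) * X k ω := fun k hk =>
    (((measurable_history X (Finset.mem_Icc.1 hk).1 (Finset.mem_Icc.1 hk).2).const_mul
      _).const_add _).stronglyMeasurable
  have hfb : ∀ k ∈ Finset.Icc 1 n, ∀ ω, ‖q + (p - q) * X k ω‖ ≤ |q| + |p - q| := fun k hk ω => by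
    refine (norm_add_le _ _).trans (add_le_add le_rfl ?_)
    rw [norm_mul]
    exact mul_le_of_le_one_right (norm_nonneg _) (hX.abs_step_le (Finset.mem_Icc.1 hk).1 ω)
  have hterm : ∀ k ∈ Finset.Icc 1 n,
      P[(fun ω => q + (p - q) * X k ω) * I k | history X n]
        =ᵐ[P] fun ω => (q + (p - q) * X k ω) * (1 / n) := by
    intro k hk
    have h1 : P[I k | history X n] =ᵐ[P] fun _ => ∫ ω, I k ω ∂P :=
      condExp_indep_eq hK.comap_le hle (hImeas k) (hX.recall_indep n hn)
    have h2 : ∫ ω, I k ω ∂P = 1 / (n : ℝ) := by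
      rw [hI, integral_indicator_const _ (hK (MeasurableSet.singleton k)), smul_eq_mul, mul_one]
      exact hX.recall_uniform n hn k hk
    filter_upwards [condExp_stronglyMeasurable_mul_of_bound hle (hfm k hk) (hIint k) _
      (Eventually.of_forall (hfb k hk)), h1] with ω h3 h4
    rw [h3, Pi.mul_apply, h4, h2]
  have hsum : P[∑ k ∈ Finset.Icc 1 n, (fun ω => q + (p - q) * X k ω) * I k | history X n]
      =ᵐ[P] ∑ k ∈ Finset.Icc 1 n, P[(fun ω => q + (p - q) * X k ω) * I k | history X n] :=
    condExp_finsetSum (fun k hk => (hIint k).bdd_mul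
      ((hfm k hk).mono hle).aestronglyMeasurable (Eventually.of_forall (hfb k hk))) _
  have hall : ∀ᵐ ω ∂P, ∀ k ∈ Finset.Icc 1 n,
      (P[(fun ω => q + (p - q) * X k ω) * I k | history X n]) ω
        = (q + (p - q) * X k ω) * (1 / n) :=
    (ae_ball_iff (Finset.Icc 1 n).countable_toSet).2 hterm
  have htower : P[X (n + 1) | history X n] =ᵐ[P]
      P[P[X (n + 1) | history X n ⊔ MeasurableSpace.comap (K (n + 1)) inferInstance]
        | history X n] := (condExp_condExp_of_le le_sup_left hsup).symm
  filter_upwards [htower.trans (condExp_congr_ae hstep), hsum, hall] with ω h1 h2 h3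
  have hn0 : (n : ℝ) ≠ 0 := by positivity
  rw [h1, h2, Finset.sum_apply, Finset.sum_congr rfl h3, ← Finset.sum_mul,
    Finset.sum_add_distrib, ← Finset.mul_sum, stepProb, position]
  simp only [Finset.sum_const, Nat.card_Icc, add_tsub_cancel_right, nsmul_eq_mul]
  field_simp

theorem stepProb_mem (hX : IsMRW P s p q X K) (hp : p ∈ Set.Icc (0 : ℝ) 1)
    (hq : q ∈ Set.Icc (0 : ℝ) 1) (n : ℕ) (ω : Ω) : stepProb p q X n ω ∈ Set.Icc (0 : ℝ) 1 := by
  have h0 : 0 ≤ position X n ω / n := div_nonneg (hX.position_nonneg n ω) n.cast_nonneg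
  have h1 : position X n ω / n ≤ 1 := div_le_one_of_le₀ (hX.position_le n ω) n.cast_nonneg
  rw [stepProb]
  have h2 := mul_nonneg h0 hp.1
  have h3 := mul_nonneg (sub_nonneg.2 h1) hq.1
  have h4 := mul_nonneg h0 (sub_nonneg.2 hp.2)
  have h5 := mul_nonneg (sub_nonneg.2 h1) (sub_nonneg.2 hq.2)
  constructor <;> nlinarith

/-- The filtration of the steps, started at time `2`. -/
noncomputable def filtration (hX : IsMRW P s p q X K) : Filtration ℕ m0 where
  -- At time `1` the scale vanishes because `log 1 = 0`.
  seq n := history X (n + 2)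
  mono' _ _ h := history_mono X (by omega)
  le' n := hX.history_le _

theorem isBoundedNoise [IsProbabilityMeasure P] (hX : IsMRW P s p q X K)
    (hp : p ∈ Set.Icc (0 : ℝ) 1) (hq : q ∈ Set.Icc (0 : ℝ) 1) :
    IsBoundedNoise P hX.filtration fun n ω => X (n + 3) ω - stepProb p q X (n + 2) ω where
  stronglyMeasurable n :=
    ((measurable_history X (by omega) le_rfl).sub
      ((measurable_stepProb p q X (n + 2)).mono (history_mono X (by omega))
        le_rfl)).stronglyMeasurable
  abs_le_one n ω := by
    have h1 := hX.stepProb_mem hp hq (n + 2) ω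
    rw [abs_le]
    rcases hX.step_mem (n + 3) (by omega) ω with h | h <;> rw [h] <;>
      constructor <;> linarith [h1.1, h1.2]
  condExp_eq_zero n := by
    have hXi : Integrable (X (n + 3)) P :=
      Integrable.of_bound (hX.measurable_step _ (by omega)).aestronglyMeasurable 1
        (Eventually.of_forall (hX.abs_step_le (by omega)))
    have hm : StronglyMeasurable[history X (n + 2)] (stepProb p q X (n + 2)) :=
      (measurable_stepProb p q X (n + 2)).stronglyMeasurable
    have hpi : Integrable (stepProb p q X (n + 2)) P :=
      integrable_of_abs_le (hX.history_le _) hm ⟨1, fun ω => by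
        have h1 := hX.stepProb_mem hp hq (n + 2) ω
        rw [abs_of_nonneg h1.1]
        exact h1.2⟩
    have h1 : P[X (n + 3) - stepProb p q X (n + 2) | history X (n + 2)] =ᵐ[P]
        P[X (n + 3) | history X (n + 2)] - P[stepProb p q X (n + 2) | history X (n + 2)] :=
      condExp_sub hXi hpi _
    rw [condExp_of_stronglyMeasurable (hX.history_le _) hm hpi] at h1
    filter_upwards [h1, hX.condExp_step (n := n + 2) (by omega)] with ω h2 h3
    refine h2.trans ?_
    rw [Pi.sub_apply, h3]
    simp

end IsMRW

/-! ### The walk as a perturbed recursion, and the conclusion. -/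

/-- The position of the walk at time `n`, centred and rescaled by `√(n log n)`. -/
noncomputable def rescaled {Ω : Type*} (q : ℝ) (X : ℕ → Ω → ℝ) (n : ℕ) (ω : Ω) : ℝ :=
  (position X n ω - 2 * q * n) / scale n

theorem IsMRW.isPerturbedRecursion {Ω : Type*} [MeasurableSpace Ω] {P : Measure Ω}
    [IsProbabilityMeasure P] {s p q : ℝ} {X : ℕ → Ω → ℝ} {K : ℕ → Ω → ℕ}
    (hX : IsMRW P s p q X K) (hp : p ∈ Set.Icc (0 : ℝ) 1) (hq : q ∈ Set.Icc (0 : ℝ) 1)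
    (hα : p - q = 1 / 2) :
    IsPerturbedRecursion P hX.filtration (fun n => rescaled q X (n + 2))
      (fun n ω => X (n + 3) ω - stepProb p q X (n + 2) ω)
      (fun n ω => 1 - 2 * stepProb p q X (n + 2) ω)
      (fun n => contraction (n + 2)) (fun n => 1 / scale (n + 3)) (fun n => logWeight (n + 2))
      (fun n => errorBound (n + 2)) (fun n => scale (n + 2) / (n + 2 : ℕ))
      (4 * q * (1 - p)) where
  noise := hX.isBoundedNoise hp hq
  stronglyMeasurable n :=
    (((measurable_position X (n + 2)).sub_const _).div_const _).stronglyMeasurable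
  bounded n := by
    refine ⟨((n + 2 : ℕ) + |2 * q * (n + 2 : ℕ)|) / scale (n + 2), fun ω => ?_⟩
    have h1 := scale_pos (show 2 ≤ n + 2 by omega)
    rw [rescaled, abs_div, abs_of_pos h1]
    gcongr
    refine (abs_sub _ _).trans (add_le_add ?_ le_rfl)
    rw [abs_of_nonneg (hX.position_nonneg _ _)]
    exact hX.position_le _ _
  step n ω := by
    have h1 := (scale_pos (show 2 ≤ n + 2 by omega)).ne'
    have h2 := (scale_pos (show 2 ≤ n + 2 + 1 by omega)).ne'
    have h3 : ((n + 2 : ℕ) : ℝ) ≠ 0 := by positivity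
    have h4 : ((n + 2 + 1 : ℕ) : ℝ) = (n + 2 : ℕ) + 1 := Nat.cast_succ _
    rw [show n + 1 + 2 = n + 2 + 1 by ring, show n + 3 = n + 2 + 1 by ring, rescaled, rescaled,
      contraction, stepProb, position_succ, hα, h4]
    generalize ((n + 2 : ℕ) : ℝ) = N at *
    field_simp
    ring
  stronglyMeasurable_b n :=
    (((measurable_stepProb p q X (n + 2)).const_mul _).const_sub _).stronglyMeasurable
  abs_b_le n ω := by
    have h1 := hX.stepProb_mem hp hq (n + 2) ω
    rw [abs_le]
    constructor <;> linarith [h1.1, h1.2]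
  abs_sq_noise_le n ω := by
    have h1 := hX.stepProb_mem hp hq (n + 2) ω
    have h2 := (scale_pos (show 2 ≤ n + 2 by omega)).ne'
    have h3 : ((n + 2 : ℕ) : ℝ) ≠ 0 := by positivity
    have h4 : stepProb p q X (n + 2) ω - 2 * q =
        scale (n + 2) / (n + 2 : ℕ) * rescaled q X (n + 2) ω / 2 := by
      rw [stepProb, rescaled, hα]
      field_simp
      ring
    have h5 : 0 ≤ scale (n + 2) / (n + 2 : ℕ) := div_nonneg (Real.sqrt_nonneg _) (Nat.cast_nonneg _)
    have hX01 : X (n + 3) ω ^ 2 = X (n + 3) ω := by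
      rcases hX.step_mem (n + 3) (by omega) ω with h | h <;> simp [h]
    -- With `π` the step probability, `X ^ 2 = X` gives `ε ^ 2 = π * (1 - π) + (1 - 2 * π) * ε`. At
    -- `π = 2 * q` the variance is `2 * q * (1 - 2 * q) = 4 * q * (1 - p)`, so the difference has
    -- the factor `π - 2 * q`, proportional to the rescaled position.
    have h6 : (X (n + 3) ω - stepProb p q X (n + 2) ω) ^ 2 -
        (1 - 2 * stepProb p q X (n + 2) ω) * (X (n + 3) ω - stepProb p q X (n + 2) ω) -
        4 * q * (1 - p) =
        (stepProb p q X (n + 2) ω - 2 * q) * (1 - 2 * q - stepProb p q X (n + 2) ω) := by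
      linear_combination hX01 + 4 * q * hα
    have h7 : |1 - 2 * q - stepProb p q X (n + 2) ω| ≤ 1 := by
      have := hp.2
      have := hq.1
      rw [abs_le]
      constructor <;> linarith [h1.1, h1.2]
    rw [h6, h4, abs_mul, abs_div, abs_mul, abs_of_nonneg h5, abs_two]
    have h8 : 0 ≤ scale (n + 2) / (n + 2 : ℕ) * |rescaled q X (n + 2) ω| :=
      mul_nonneg h5 (abs_nonneg _)
    have h9 := mul_le_mul_of_nonneg_left h7 (div_nonneg h8 zero_le_two)
    linarith
  β_nonneg n := contraction_nonneg (by omega)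
  β_le_one n := contraction_le_one (by omega)
  h_nonneg n := div_nonneg zero_le_one (Real.sqrt_nonneg _)
  δ_nonneg n := logWeight_nonneg _
  δ_le_one n := logWeight_le_one (by omega)
  h_sq_le n := by
    rw [inv_scale_sq (by omega)]
    exact logWeight_antitone (by omega)
  not_summable_δ := not_summable_logWeight
  summable_γ := summable_errorBound
  abs_β_le n := by
    refine (abs_contraction_sq_le (by omega)).trans ?_
    rw [errorBound]
    have : 0 ≤ 1 / (((n + 2 : ℕ) : ℝ) * √((n + 2 : ℕ) : ℝ)) := by positivity
    linarith
  abs_h_le n := by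
    have h1 := logWeight_antitone (show 2 ≤ n + 2 by omega)
    rw [inv_scale_sq (by omega), abs_sub_comm, abs_of_nonneg (sub_nonneg.2 h1), errorBound]
    have : 0 ≤ 1 / (((n + 2 : ℕ) : ℝ) * √((n + 2 : ℕ) : ℝ)) := by positivity
    linarith
  δ_sq_le n := by
    have h1 := logWeight_antitone (show 2 ≤ n + 2 by omega)
    refine (logWeight_sq_le (by omega)).trans ?_
    rw [errorBound]
    linarith
  h_cube_le n := by
    have h1 := logWeight_antitone (show 2 ≤ n + 2 by omega)
    refine (inv_scale_succ_cube_le (show 2 ≤ n + 2 by omega)).trans ?_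
    rw [errorBound]
    have : 0 ≤ 1 / (((n + 2 : ℕ) : ℝ) * √((n + 2 : ℕ) : ℝ)) := by positivity
    linarith
  δ_mul_κ_le n := by
    have h1 := logWeight_antitone (show 2 ≤ n + 2 by omega)
    refine (logWeight_mul_scale_div_le (by omega)).trans ?_
    rw [errorBound]
    linarith

/-- The summand of the logarithmic average in terms of the rescaled walk. -/
theorem logWeight_mul_rescaled_pow {Ω : Type*} (q : ℝ) (X : ℕ → Ω → ℝ) {r k : ℕ} (hr : 1 ≤ r)
    (hk : 2 ≤ k) (ω : Ω) :
    (1 / Real.log (k : ℝ)) ^ (r + 1) * (k : ℝ) ^ (r - 1) *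
      (position X k ω / (k : ℝ) - 2 * q) ^ (2 * r) = logWeight k * rescaled q X k ω ^ (2 * r) := by
  obtain ⟨r, rfl⟩ := Nat.exists_eq_add_of_le' hr
  have h1 : Real.log k ≠ 0 := by linarith [half_le_log hk]
  have h2 : (k : ℝ) ≠ 0 := by positivity
  have h3 : position X k ω / (k : ℝ) - 2 * q = (position X k ω - 2 * q * k) / k := by
    field_simp
  rw [h3, rescaled, div_pow _ (scale k), pow_mul (scale k), scale_sq hk, logWeight, div_pow,
    mul_pow, Nat.add_sub_cancel, div_pow]
  have h4 : (k : ℝ) ^ (2 * (r + 1)) = k ^ r * (k * k ^ (r + 1)) := by ring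
  rw [h4]
  field_simp
  ring

end MinimalRandomWalk

theorem theorem4 {Ω : Type*} [MeasurableSpace Ω] (P : Measure Ω) [IsProbabilityMeasure P]
    (s p q : ℝ) (hs : s ∈ Set.Ioo (0 : ℝ) 1) (hp : p ∈ Set.Icc (0 : ℝ) 1)
    (hq : q ∈ Set.Ioc (0 : ℝ) 1) (hα : p - q = 1 / 2)
    (X : ℕ → Ω → ℝ) (K : ℕ → Ω → ℕ) (hX : MinimalRandomWalk.IsMRW P s p q X K)
    (r : ℕ) (hr : 1 ≤ r) :
    ∀ᵐ ω ∂P, Tendsto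
      (fun n : ℕ => 1 / Real.log (Real.log (n : ℝ)) *
        ∑ k ∈ Finset.Icc 2 n, (1 / Real.log (k : ℝ)) ^ (r + 1) * (k : ℝ) ^ (r - 1) *
          (MinimalRandomWalk.position X k ω / (k : ℝ) - 2 * q) ^ (2 * r))
      atTop
      (𝓝 ((4 * q * (1 - p)) ^ r * (Nat.factorial (2 * r) : ℝ) /
        (2 ^ r * (Nat.factorial r : ℝ)))) := by
  have S := hX.isPerturbedRecursion hp ⟨hq.1.le, hq.2⟩ hα
  filter_upwards [S.ae_tendsto_weighted_sum r] with ω hω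
  -- The sum over `k = 2, …, n + 2` has `n + 1` terms, hence the shift by `1` here and by `2` in the
  -- goal.
  have h1 := (hω.comp (tendsto_add_atTop_nat 1)).mul
    MinimalRandomWalk.tendsto_cumWeight_div_loglog
  rw [mul_one] at h1
  rw [← tendsto_add_atTop_iff_nat 2]
  refine h1.congr fun n => ?_
  have h2 : ∑ k ∈ Finset.Icc 2 (n + 2), (1 / Real.log (k : ℝ)) ^ (r + 1) * (k : ℝ) ^ (r - 1) *
      (MinimalRandomWalk.position X k ω / (k : ℝ) - 2 * q) ^ (2 * r) =
      ∑ k ∈ Finset.range (n + 1), MinimalRandomWalk.logWeight (k + 2) *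
        MinimalRandomWalk.rescaled q X (k + 2) ω ^ (2 * r) := by
    rw [Finset.range_eq_Ico, Finset.sum_Ico_add' (fun k => MinimalRandomWalk.logWeight k *
      MinimalRandomWalk.rescaled q X k ω ^ (2 * r))]
    exact Finset.sum_congr rfl fun k hk =>
      MinimalRandomWalk.logWeight_mul_rescaled_pow q X hr (Finset.mem_Icc.1 hk).1 ω
  rw [h2]
  have h3 := (MinimalRandomWalk.cumWeight_pos
    (fun k => MinimalRandomWalk.logWeight_nonneg (k + 2)) (n + 1)).ne'
  simp only [Function.comp_apply]
  rw [div_mul_div_comm, mul_comm _ (MinimalRandomWalk.cumWeight _ _), mul_div_mul_left _ _ h3,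
    one_div_mul_eq_div]
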